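/- Let $G$ be a finite additive group of order $n$, and $G^*=G\setminus\{0\}$. A subset $P\subseteq G$ with $|P|=k$ is an $(n,k,\lambda,\mu)$-partial difference set (PDS), with $\lambda,\mu$ non-negative integers, if the multiset of differences $\{x-y : x,y\in P,\ x\ne y\}$ consists of $\lambda$ copies of each element of $P$ and $\mu$ copies of each element of $G^*\setminus P$; it is proper if $\lambda\neq\mu$. Let $q=p^m$ be a power of a prime $p$, let $\alpha$ be a primitive element of the finite field $\mathrm{GF}(q)$, and for $e\mid q-1$ let $C_0^e=\langle\alpha^e\rangle\subseteq \mathrm{GF}(q)^*$. By the proper representations of $q$ below (in integers) we mean those in which, moreover, $p\nmid c$ if $p\equiv1\pmod 3$ in (i); $p\nmid s$ if $p\equiv 1\pmod 4$ in (ii); $p\nmid s$ if $p\equiv1\pmod 6$ in (iii); and $p\nmid x$ if $p\equiv 1\pmod 4$, $p\nmid a$ if $p\equiv 1,3\pmod 8$ in (iv) (for the other primes $p$ nothing further is required). (i) Let $q\equiv1\pmod 3$. Then $C_0^3$ is a PDS in $(\mathrm{GF}(q),+)$ if and only if $p\equiv2\pmod3$ and $m$ is even. If $4q=c^2+27d^2$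 with $c\equiv1\pmod3$ is the proper representation, then $C_0^3$ is a PDS if and only if $d=0$; in that case its parameters are $\left(q,\frac{q-1}{3},\frac{q-8+c}{9},\frac{2q-4-c}{18}\right)$, and it is proper except precisely in the trivial case $q=4$. (ii) Let $q\equiv1\pmod 4$. Then $C_0^4$ is a proper PDS if and only if $p\equiv3\pmod4$ and $m$ is even. If $q=s^2+4t^2$ with $s\equiv1\pmod4$ is the proper representation, then $C_0^4$ is a proper PDS if and only if $t=0$; in that case its parameters are $\left(q,\frac{q-1}{4},\frac{q-11-6s}{16},\frac{q-3+2s}{16}\right)$. (iii) Let $q\equiv1\pmod 6$. Then $C_0^6$ is a proper PDS if and only if $p\equiv5\pmod6$ and $m$ is even. If $q=s^2+3t^2$ with $s\equiv1\pmod3$ is the proper representation, then $C_0^6$ is a proper PDS if and only if $t=0$; in that case its parameters are $\left(q,\frac{q-1}{6},\frac{q-17-20s}{36},\frac{q-5+4s}{36}\right)$. (iv) Let $q\equiv1\pmod 8$. Then $C_0^8$ is a proper PDS if and only if $p\equiv7\pmod8$ and $m$ is even. If $q=x^2+4y^2=a^2+2b^2$ with $x\equiv a\equiv1\pmod4$ are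 the proper representations, then $C_0^8$ is a proper PDS if and only if $x=a$ and $y=b=0$; in that case its parameters are $\left(q,\frac{q-1}{8},\frac{q-23-42x}{64},\frac{q-7+6x}{64}\right)$. -/

import Mathlib

/-- The multiset `Δ(D) = {x - y : x, y ∈ D, x ≠ y}` of internal differences of `D`. -/
def internalDifferences {G : Type*} [AddGroup G] [DecidableEq G] (D : Finset G) : Multiset G :=
  D.offDiag.val.map fun z => z.1 - z.2

/-- `P` is an `(n, k, lam, mu)`-partial difference set in the additive group `G`:
`|G| = n`, `|P| = k` and `Δ(P) = lam · P + mu · (G* \ P)` as multisets, with `G* = G \ {0}`.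
The case `lam = mu` (a difference set) is allowed. -/
def IsPDS {G : Type*} [AddGroup G] [Fintype G] [DecidableEq G]
    (P : Finset G) (n k lam mu : ℕ) : Prop :=
  Fintype.card G = n ∧ P.card = k ∧
    internalDifferences P = lam • P.val + mu • ((Finset.univ \ {0}) \ P).val

/-- A proper partial difference set is one whose two frequencies differ. -/
def IsProperPDS {G : Type*} [AddGroup G] [Fintype G] [DecidableEq G]
    (P : Finset G) (n k lam mu : ℕ) : Prop :=
  IsPDS P n k lam mu ∧ lam ≠ mu

open Classical in
/-- The cyclotomic class `C_i^e = α^i ⟨α^e⟩` of order `e`, as a subset of the field. -/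
noncomputable def cyclotomicClass {F : Type*} [Field F] [Fintype F]
    (α : Fˣ) (e i : ℕ) : Finset F :=
  Finset.univ.filter fun x => ∃ u ∈ Subgroup.zpowers (α ^ e), x = ((α ^ i * u : Fˣ) : F)

/-! Normalized proper representations of a power `q` of the prime `p`.  Where `p` splits in the
relevant quadratic ring, "proper" means that `p` does not divide the first variable.  For the
other primes no coprime representation exists and the only normalized representation is the
degenerate one, with second variable `0`; this needs no separate clause. -/

/-- `4q = c² + 27d²` is the proper representation with `c ≡ 1 (mod 3)`. -/
def IsProperRepCubic (p q : ℕ) (c d : ℤ) : Prop :=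
  4 * (q : ℤ) = c ^ 2 + 27 * d ^ 2 ∧ c ≡ 1 [ZMOD 3] ∧ (p % 3 = 1 → ¬ (p : ℤ) ∣ c)

/-- `q = s² + 4t²` is the proper representation with `s ≡ 1 (mod 4)`. -/
def IsProperRepQuartic (p q : ℕ) (s t : ℤ) : Prop :=
  (q : ℤ) = s ^ 2 + 4 * t ^ 2 ∧ s ≡ 1 [ZMOD 4] ∧ (p % 4 = 1 → ¬ (p : ℤ) ∣ s)

/-- `q = s² + 3t²` is the proper representation with `s ≡ 1 (mod 3)`. -/
def IsProperRepSextic (p q : ℕ) (s t : ℤ) : Prop :=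
  (q : ℤ) = s ^ 2 + 3 * t ^ 2 ∧ s ≡ 1 [ZMOD 3] ∧ (p % 6 = 1 → ¬ (p : ℤ) ∣ s)

/-- `q = a² + 2b²` is the proper representation with `a ≡ 1 (mod 4)`. -/
def IsProperRepOctic (p q : ℕ) (a b : ℤ) : Prop :=
  (q : ℤ) = a ^ 2 + 2 * b ^ 2 ∧ a ≡ 1 [ZMOD 4] ∧ (p % 8 = 1 ∨ p % 8 = 3 → ¬ (p : ℤ) ∣ a)

/-! Since `q = e * f + 1`, the class `C_0^e` is the group `U` of `f`-th roots of unity, and the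
question is when the difference counts of `U` are constant on `U` and on its nonzero complement.

Necessity is a computation in characteristic `p`. Summing `(x - y) ^ (a * f)` over `U × U` with `0 <
a < e` kills the `mu`-term and gives `lam - mu = f * ∑ t, (a * f).choose (t * f)` in `F`
(`IsPDS.sub_eq_sum_choose`). The signs disappear because `-1 ∈ U`, which properness guarantees.
Comparing `a = 1` with `a = 2` or `a = 3` forces `p` to divide `(2 * f).choose f` or `(3 * f).choose
f`. The base-`p` digits of `f` are explicit, and Lucas' theorem excludes this unless `p ≡ -1` mod
`e`; then `q ≡ 1` mod `e` makes `m` even.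

For sufficiency let `e ∣ p + 1` and `q = p ^ (2 * j)`. The sums of `ψ (b * x ^ (p + 1))` have square
`q` or `q * p ^ 2`, and a congruence modulo `p + 1` fixes their sign (`hermitianSum_eq`). Hence the
Gaussian periods take two values, expressed through `σ = (-p) ^ j` (`charSum_unityRoots`), and
Fourier inversion yields the difference counts (`diffCount_eq_of_charSum`).

Finally, for these `p` the quadratic forms are anisotropic at `p`, so descent makes the second
variable vanish (`eq_zero_of_descent`); the first is then `±σ` (`±2σ` for cubes), with sign fixed by
its normalization. -/

open Finset

/-! ### Partial difference sets through difference counts. -/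

section PartialDifferenceSets

variable {G : Type*} [AddGroup G] [DecidableEq G]

/-- The number of representations of `g` as a difference of two elements of `D`. -/
def diffCount (D : Finset G) (g : G) : ℕ := #{z ∈ D ×ˢ D | z.1 - z.2 = g}

lemma count_internalDifferences (D : Finset G) {g : G} (hg : g ≠ 0) :
    (internalDifferences D).count g = diffCount D g := by
  rw [internalDifferences, Multiset.count_map, diffCount, ← Finset.filter_val, Finset.card_val]
  congr 1
  ext ⟨x, y⟩
  simp only [mem_filter, mem_offDiag, mem_product]
  constructor
  · rintro ⟨⟨hx, hy, -⟩, h⟩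
    exact ⟨⟨hx, hy⟩, h.symm⟩
  · rintro ⟨⟨hx, hy⟩, h⟩
    refine ⟨⟨hx, hy, fun hxy => hg ?_⟩, h.symm⟩
    rw [← h, hxy, sub_self]

lemma count_zero_internalDifferences (D : Finset G) :
    (internalDifferences D).count 0 = 0 := by
  rw [Multiset.count_eq_zero, internalDifferences]
  simp [sub_eq_zero]

variable [Fintype G] {P : Finset G} {n k lam mu : ℕ}

lemma isPDS_iff_diffCount (hP : (0 : G) ∉ P) :
    IsPDS P n k lam mu ↔ Fintype.card G = n ∧ #P = k ∧
      ∀ g : G, g ≠ 0 → diffCount P g = if g ∈ P then lam else mu := by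
  have key (g : G) : (lam • P.val + mu • ((Finset.univ \ {0}) \ P).val).count g =
      if g = 0 then 0 else if g ∈ P then lam else mu := by
    have h1 : P.val.count g = if g ∈ P then 1 else 0 := Multiset.count_eq_of_nodup P.nodup
    have h2 : ((Finset.univ \ {0}) \ P).val.count g =
        if g ∈ (Finset.univ \ {0}) \ P then 1 else 0 := Multiset.count_eq_of_nodup (Finset.nodup _)
    rw [Multiset.count_add, Multiset.count_nsmul, Multiset.count_nsmul, h1, h2]
    by_cases hg : g = 0
    · subst hg; simp [hP]
    · by_cases hgP : g ∈ P <;> simp [hg, hgP]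
  rw [IsPDS, Multiset.ext]
  refine and_congr_right fun _ => and_congr_right fun _ => ⟨fun h g hg => ?_, fun h g => ?_⟩
  · rw [← count_internalDifferences P hg, h g, key, if_neg hg]
  · rw [key]
    split_ifs with h0 hgP
    · rw [h0, count_zero_internalDifferences]
    · rw [count_internalDifferences P h0, h g h0, if_pos hgP]
    · rw [count_internalDifferences P h0, h g h0, if_neg hgP]

/-- Integrates `φ` against the defining multiset identity; `φ 0 = 0` makes the diagonal and the
missing zero element harmless. -/
lemma IsPDS.sum_sub {R : Type*} [CommRing R] (h : IsPDS P n k lam mu) (hP : (0 : G) ∉ P)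
    (φ : G → R) (hφ : φ 0 = 0) :
    ∑ x ∈ P, ∑ y ∈ P, φ (x - y) =
      (lam - mu) * ∑ x ∈ P, φ x + mu * ∑ x : G, φ x := by
  have h1 : ∑ x ∈ P, ∑ y ∈ P, φ (x - y) = ((internalDifferences P).map φ).sum := by
    rw [internalDifferences, Multiset.map_map, ← Finset.sum_product', ← Finset.diag_union_offDiag,
      Finset.sum_union (Finset.disjoint_diag_offDiag P), Finset.sum_eq_zero]
    · rw [zero_add]; rfl
    · rintro ⟨x, y⟩ hxy
      obtain rfl : x = y := (Finset.mem_diag.1 hxy).2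
      simp [hφ]
  have h2 : ∑ x : G, φ x = ∑ x ∈ P, φ x + ∑ x ∈ (Finset.univ \ {0}) \ P, φ x := by
    have hs : P ⊆ Finset.univ \ {0} := fun x hx => by
      simpa using fun h0 : x = 0 => hP (h0 ▸ hx)
    rw [add_comm, Finset.sum_sdiff hs, ← Finset.sum_sdiff (Finset.subset_univ {(0 : G)})]
    simp [hφ]
  rw [h1, h.2.2, Multiset.map_add, Multiset.sum_add, Multiset.map_nsmul, Multiset.map_nsmul,
    Multiset.sum_nsmul, Multiset.sum_nsmul, h2, nsmul_eq_mul, nsmul_eq_mul]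
  simp only [Finset.sum]
  ring

/-- A proper partial difference set that avoids zero is closed under negation. -/
lemma IsProperPDS.neg_mem (h : IsProperPDS P n k lam mu) (hP : (0 : G) ∉ P) {x : G}
    (hx : x ∈ P) : -x ∈ P := by
  obtain ⟨h, hne⟩ := h
  have hc := ((isPDS_iff_diffCount hP).1 h).2.2
  have hx0 : x ≠ 0 := fun h0 => hP (h0 ▸ hx)
  -- Swapping the entries of a pair negates its difference.
  have hs : diffCount P (-x) = diffCount P x := by
    refine Finset.card_bij' (fun z _ => (z.2, z.1)) (fun z _ => (z.2, z.1)) ?_ ?_ ?_ ?_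
    · rintro ⟨a, b⟩ hz
      simp only [mem_filter, mem_product] at hz ⊢
      exact ⟨hz.1.symm, by rw [← neg_sub, hz.2, neg_neg]⟩
    · rintro ⟨a, b⟩ hz
      simp only [mem_filter, mem_product] at hz ⊢
      exact ⟨hz.1.symm, by rw [← neg_sub, hz.2]⟩
    · simp
    · simp
  rw [hc x hx0, hc (-x) (neg_ne_zero.2 hx0), if_pos hx] at hs
  by_contra hn
  rw [if_neg hn] at hs
  exact hne hs.symm

end PartialDifferenceSets

/-! ### Roots of unity as power residues. -/

section PowerResidues

variable {F : Type*} [Field F] [Fintype F]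

lemma pow_eq_one_of_card_eq {N : ℕ} (hq : Fintype.card F = N + 1) {x : F} (hx : x ≠ 0) :
    x ^ N = 1 := by
  have := FiniteField.pow_card_sub_one_eq_one x hx
  rwa [hq, Nat.add_sub_cancel] at this

lemma ne_zero_of_card_eq {e f : ℕ} (hq : Fintype.card F = e * f + 1) : e ≠ 0 ∧ f ≠ 0 := by
  have := Fintype.one_lt_card (α := F)
  constructor <;> rintro rfl <;> simp_all

lemma cast_mul_eq_neg_one {e f : ℕ} (hq : Fintype.card F = e * f + 1) : (e : F) * f = -1 := by
  have := Nat.cast_card_eq_zero F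
  rw [hq] at this
  push_cast at this
  linear_combination this

lemma cast_right_ne_zero {e f : ℕ} (hq : Fintype.card F = e * f + 1) : (f : F) ≠ 0 := fun h0 => by
  have := cast_mul_eq_neg_one hq
  simp [h0] at this

variable [DecidableEq F]

variable (F) in
/-- The `f`-th roots of unity of `F`. -/
def unityRoots (f : ℕ) : Finset F := {x | x ^ f = 1}

@[simp] lemma mem_unityRoots {f : ℕ} {x : F} : x ∈ unityRoots F f ↔ x ^ f = 1 := by
  simp [unityRoots]

lemma zero_notMem_unityRoots {f : ℕ} (hf : f ≠ 0) : (0 : F) ∉ unityRoots F f := by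
  simp [hf]

/-- In a finite field with `e * f + 1` elements, the `f`-th roots of unity are the nonzero
`e`-th powers. -/
lemma mem_unityRoots_iff_exists_pow {e f : ℕ} (hq : Fintype.card F = e * f + 1) {x : F} :
    x ∈ unityRoots F f ↔ ∃ u : Fˣ, x = (u : F) ^ e := by
  obtain ⟨-, hf⟩ := ne_zero_of_card_eq hq
  rw [mem_unityRoots]
  constructor
  · intro hx
    obtain ⟨α, hα⟩ := IsCyclic.exists_generator (α := Fˣ)
    have hx0 : x ≠ 0 := by rintro rfl; simp [hf] at hx
    obtain ⟨k, hk⟩ := hα (Units.mk0 x hx0)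
    have ho : orderOf α = e * f := by
      rw [orderOf_eq_card_of_forall_mem_zpowers hα, Nat.card_eq_fintype_card, Fintype.card_units,
        hq, Nat.add_sub_cancel]
    have h1 : α ^ (k * f) = 1 := by
      simp only at hk
      rw [zpow_mul, hk, zpow_natCast]
      ext; simpa using hx
    rw [← orderOf_dvd_iff_zpow_eq_one, ho, Nat.cast_mul] at h1
    obtain ⟨l, rfl⟩ := Int.dvd_of_mul_dvd_mul_right (by exact_mod_cast hf) h1
    refine ⟨α ^ l, ?_⟩
    have := congrArg Units.val hk
    rw [Units.val_mk0] at this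
    rw [← this, ← Units.val_pow_eq_pow_val, ← zpow_natCast, ← zpow_mul, mul_comm]
  · rintro ⟨u, rfl⟩
    rw [← pow_mul]
    exact pow_eq_one_of_card_eq hq u.ne_zero

lemma cyclotomicClass_zero_eq {e f : ℕ} (hq : Fintype.card F = e * f + 1) (α : Fˣ)
    (hα : ∀ u : Fˣ, u ∈ Subgroup.zpowers α) :
    cyclotomicClass α e 0 = unityRoots F f := by
  ext x
  rw [mem_unityRoots_iff_exists_pow hq, cyclotomicClass]
  simp only [mem_filter, mem_univ, true_and, pow_zero, one_mul]
  constructor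
  · rintro ⟨u, ⟨k, rfl⟩, rfl⟩
    refine ⟨α ^ k, ?_⟩
    rw [← Units.val_pow_eq_pow_val]
    simp only [← zpow_natCast, ← zpow_mul, mul_comm]
  · rintro ⟨u, rfl⟩
    obtain ⟨k, rfl⟩ := hα u
    refine ⟨_, ⟨k, rfl⟩, ?_⟩
    rw [← Units.val_pow_eq_pow_val]
    simp only [← zpow_natCast, ← zpow_mul, mul_comm]

/-- Summing over `e`-th powers of units hits every `f`-th root of unity `e` times. -/
lemma sum_units_pow {R : Type*} [CommRing R] {e f : ℕ} (hq : Fintype.card F = e * f + 1)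
    (φ : F → R) : ∑ u : Fˣ, φ ((u : F) ^ e) = e * ∑ x ∈ unityRoots F f, φ x := by
  have hmaps : ∀ u ∈ (univ : Finset Fˣ), (u : F) ^ e ∈ unityRoots F f := fun u _ =>
    (mem_unityRoots_iff_exists_pow hq).2 ⟨u, rfl⟩
  rw [← Finset.sum_fiberwise_of_maps_to hmaps, Finset.mul_sum]
  refine Finset.sum_congr rfl fun x hx => ?_
  have hcard : #{u : Fˣ | (u : F) ^ e = x} = e := by
    obtain ⟨v, rfl⟩ := (mem_unityRoots_iff_exists_pow hq).1 hx
    have h1 := MonoidHom.card_fiber_eq_of_mem_range (powMonoidHom e : Fˣ →* Fˣ)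
      (x := v ^ e) (y := 1) ⟨v, rfl⟩ ⟨1, by simp⟩
    have h2 := IsCyclic.card_powMonoidHom_ker Fˣ e
    rw [Nat.card_eq_fintype_card, Nat.card_eq_fintype_card, Fintype.card_units, hq,
      Nat.add_sub_cancel, Nat.gcd_eq_right (Dvd.intro _ rfl), Fintype.card_subtype] at h2
    simp only [MonoidHom.mem_ker] at h2
    rw [h2] at h1
    refine Eq.trans ?_ h1
    congr 1
    ext u
    simp [Units.ext_iff]
  rw [Finset.sum_congr rfl (g := fun _ => φ x) (fun u hu => by rw [(mem_filter.1 hu).2]),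
    Finset.sum_const, hcard, nsmul_eq_mul]

lemma card_unityRoots {e f : ℕ} (hq : Fintype.card F = e * f + 1) : #(unityRoots F f) = f := by
  have h := sum_units_pow hq (fun _ => (1 : ℤ))
  have he := (ne_zero_of_card_eq hq).1
  simp only [sum_const, nsmul_eq_mul, mul_one, Finset.card_univ, Fintype.card_units, hq,
    Nat.add_sub_cancel] at h
  push_cast at h
  exact_mod_cast (mul_left_cancel₀ (by exact_mod_cast he) h).symm

lemma sum_unityRoots_pow {e f : ℕ} (hq : Fintype.card F = e * f + 1) (j : ℕ) :
    ∑ x ∈ unityRoots F f, x ^ j = if f ∣ j then (f : F) else 0 := by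
  have h := sum_units_pow hq (fun x : F => x ^ j)
  have hef := cast_mul_eq_neg_one hq
  have he : (e : F) ≠ 0 := by rintro h0; simp [h0] at hef
  simp only [← pow_mul] at h
  rw [FiniteField.sum_pow_units, hq, Nat.add_sub_cancel] at h
  apply mul_left_cancel₀ he
  rw [← h]
  simp only [Nat.mul_dvd_mul_iff_left (Nat.pos_of_ne_zero (ne_zero_of_card_eq hq).1)]
  split_ifs
  · exact hef.symm
  · simp

/-- Translation by an element of the group of roots of unity. -/
lemma sum_unityRoots_mul {R : Type*} [CommRing R] {f : ℕ} (φ : F → R) {y : F} (hy0 : y ≠ 0)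
    (hy : y ∈ unityRoots F f) : ∑ x ∈ unityRoots F f, φ (x * y) = ∑ x ∈ unityRoots F f, φ x := by
  rw [mem_unityRoots] at hy
  refine Finset.sum_bij' (fun x _ => x * y) (fun x _ => x * y⁻¹) ?_ ?_ ?_ ?_ ?_
  · intro x hx; rw [mem_unityRoots] at hx ⊢; rw [mul_pow, hx, hy, one_mul]
  · intro x hx; rw [mem_unityRoots] at hx ⊢; rw [mul_pow, hx, inv_pow, hy, inv_one, one_mul]
  · intro x _; simp [hy0]
  · intro x _; simp [hy0]
  · intros; rfl

end PowerResidues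

/-! ### Necessary conditions from power moments in characteristic `p`. -/

section Necessity

variable {F : Type*} [Field F] [Fintype F] [DecidableEq F]

lemma sum_range_filter_dvd {R : Type*} [CommRing R] {a f : ℕ} (hf : f ≠ 0) (g : ℕ → R) :
    ∑ i ∈ range (a * f + 1) with f ∣ i, g i = ∑ t ∈ range (a + 1), g (t * f) := by
  have hf' := Nat.pos_of_ne_zero hf
  symm
  refine Finset.sum_bij (fun t _ => t * f) ?_ ?_ ?_ (fun _ _ => rfl)
  · intro t ht
    rw [mem_range] at ht
    rw [mem_filter, mem_range]
    exact ⟨Nat.lt_succ_of_le (Nat.mul_le_mul_right _ (Nat.le_of_lt_succ ht)), Dvd.intro_left _ rfl⟩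
  · intro t _ t' _ h
    exact Nat.eq_of_mul_eq_mul_right hf' h
  · intro i hi
    rw [mem_filter, mem_range] at hi
    obtain ⟨hi, t, rfl⟩ := hi
    refine ⟨t, ?_, mul_comm _ _⟩
    rw [mem_range]
    have : f * t ≤ f * a := by rw [mul_comm f a]; omega
    exact Nat.lt_succ_of_le (Nat.le_of_mul_le_mul_left this hf')

/-- After binomial expansion only exponents divisible by `f` survive summation over the group, and
`hneg` removes their signs. -/
lemma sum_unityRoots_sub_one_pow {e f : ℕ} (hq : Fintype.card F = e * f + 1)
    (hneg : (-1 : F) ^ f = 1) (a : ℕ) :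
    ∑ x ∈ unityRoots F f, (x - 1) ^ (a * f) =
      f * ∑ t ∈ range (a + 1), ((a * f).choose (t * f) : F) := by
  have hf := (ne_zero_of_card_eq hq).2
  simp only [sub_eq_add_neg, add_pow]
  rw [Finset.sum_comm]
  have h1 (i : ℕ) : ∑ x ∈ unityRoots F f, x ^ i * (-1) ^ (a * f - i) * ((a * f).choose i : F) =
      if f ∣ i then (-1) ^ (a * f - i) * ((a * f).choose i : F) * f else 0 := by
    simp only [mul_assoc]
    rw [← Finset.sum_mul, sum_unityRoots_pow hq]
    split_ifs <;> ring
  simp only [h1]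
  rw [← Finset.sum_filter, sum_range_filter_dvd hf, Finset.mul_sum]
  refine Finset.sum_congr rfl fun t _ => ?_
  rw [← Nat.sub_mul, mul_comm _ f, pow_mul, hneg, one_pow]
  ring

/-- The value of `lam - mu` in the field itself, from the power moments of the differences. -/
lemma IsPDS.sub_eq_sum_choose {e f n k lam mu : ℕ} (hq : Fintype.card F = e * f + 1)
    (h : IsPDS (unityRoots F f) n k lam mu) (hneg : (-1 : F) ^ f = 1) {a : ℕ} (ha : 0 < a)
    (hae : a < e) :
    (lam - mu : F) = f * ∑ t ∈ range (a + 1), ((a * f).choose (t * f) : F) := by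
  have hf := (ne_zero_of_card_eq hq).2
  have hf' := cast_right_ne_zero hq
  have key := h.sum_sub (zero_notMem_unityRoots hf) (fun x : F => x ^ (a * f))
    (zero_pow (mul_ne_zero ha.ne' hf))
  have hlt : a * f < Fintype.card F - 1 := by
    rw [hq, Nat.add_sub_cancel]
    exact Nat.mul_lt_mul_of_pos_right hae (Nat.pos_of_ne_zero hf)
  have hP : ∀ y ∈ unityRoots F f, y ^ (a * f) = 1 := fun y hy => by
    rw [mul_comm, pow_mul, mem_unityRoots.1 hy, one_pow]
  -- The exponent is below `q - 1`, so the power sum over the whole field, and with it the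
  -- `mu`-term, vanishes.
  rw [FiniteField.sum_pow_lt_card_sub_one F _ hlt, mul_zero, add_zero,
    Finset.sum_congr rfl hP, Finset.sum_const, card_unityRoots hq, nsmul_one,
    Finset.sum_comm] at key
  have h2 : ∀ y ∈ unityRoots F f, ∑ x ∈ unityRoots F f, (x - y) ^ (a * f) =
      ∑ x ∈ unityRoots F f, (x - 1) ^ (a * f) := fun y hy => by
    have hy0 : y ≠ 0 := fun h0 => zero_notMem_unityRoots hf (h0 ▸ hy)
    rw [← sum_unityRoots_mul (fun x => (x - y) ^ (a * f)) hy0 hy]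
    refine Finset.sum_congr rfl fun x _ => ?_
    rw [show x * y - y = (x - 1) * y by ring, mul_pow, hP y hy, mul_one]
  rw [Finset.sum_congr rfl h2, Finset.sum_const, card_unityRoots hq, nsmul_eq_mul,
    sum_unityRoots_sub_one_pow hq hneg, mul_comm] at key
  exact (mul_right_cancel₀ hf' key).symm

/-- A cyclotomic partial difference set containing `-1` forces carries in `f + f`. -/
lemma IsPDS.dvd_choose_two {e f n k lam mu p : ℕ} [CharP F p]
    (hq : Fintype.card F = e * f + 1)
    (h : IsPDS (unityRoots F f) n k lam mu) (hneg : (-1 : F) ^ f = 1) (he : 2 < e) :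
    p ∣ (2 * f).choose f := by
  have hf' := cast_right_ne_zero hq
  -- The binomial sum is `2` for `a = 1` and `2 + (2 * f).choose f` for `a = 2`.
  have h1 := h.sub_eq_sum_choose hq hneg (a := 1) (by omega) (by omega)
  have h2 := h.sub_eq_sum_choose hq hneg (a := 2) (by omega) (by omega)
  rw [h1] at h2
  have h3 := mul_left_cancel₀ hf' h2
  simp only [sum_range_succ, range_zero, sum_empty, one_mul, zero_mul, Nat.choose_zero_right,
    Nat.choose_self] at h3
  rw [← CharP.cast_eq_zero_iff F p]
  linear_combination -h3

/-- Comparing `a = 1` with `a = 3` gives `2 = 2 + 2 * (3 * f).choose f`, hence the need for `2 ≠ 0`.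
-/
lemma IsPDS.dvd_choose_three {e f n k lam mu p : ℕ} [CharP F p]
    (hq : Fintype.card F = e * f + 1) (hp2 : (2 : F) ≠ 0)
    (h : IsPDS (unityRoots F f) n k lam mu) (hneg : (-1 : F) ^ f = 1) (he : 3 < e) :
    p ∣ (3 * f).choose f := by
  have hf' := cast_right_ne_zero hq
  have h1 := h.sub_eq_sum_choose hq hneg (a := 1) (by omega) (by omega)
  have h2 := h.sub_eq_sum_choose hq hneg (a := 3) (by omega) (by omega)
  rw [h1] at h2
  have h3 := mul_left_cancel₀ hf' h2
  have hs : (3 * f).choose (2 * f) = (3 * f).choose f := Nat.choose_symm_of_eq_add (by ring)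
  simp only [sum_range_succ, range_zero, sum_empty, one_mul, zero_mul, Nat.choose_zero_right,
    Nat.choose_self, hs] at h3
  rw [← CharP.cast_eq_zero_iff F p]
  apply mul_left_cancel₀ hp2
  linear_combination -h3

end Necessity

/-! ### Binomial coefficients modulo `p` via Lucas' theorem. -/

section Lucas

variable {p : ℕ} [hp : Fact p.Prime]

/-- One step of Lucas' theorem: a base-`p` digit without carry does not create divisibility. -/
lemma not_dvd_choose_digit {n k a b : ℕ} (hab : b ≤ a) (hap : a < p) (h : ¬ p ∣ n.choose k) :
    ¬ p ∣ (p * n + a).choose (p * k + b) := by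
  have hL := Choose.choose_modEq_choose_mod_mul_choose_div_nat
    (n := p * n + a) (k := p * k + b) (p := p)
  rw [Nat.mul_add_mod, Nat.mul_add_mod, Nat.mod_eq_of_lt hap, Nat.mod_eq_of_lt (hab.trans_lt hap),
    Nat.mul_add_div hp.out.pos, Nat.mul_add_div hp.out.pos, Nat.div_eq_of_lt hap,
    Nat.div_eq_of_lt (hab.trans_lt hap), add_zero, add_zero] at hL
  intro hd
  have h0 := ((Nat.modEq_zero_iff_dvd.2 hd).symm.trans hL).symm
  rcases hp.out.dvd_mul.1 (Nat.modEq_zero_iff_dvd.1 h0) with h1 | h1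
  · have h2 : p ∣ a.factorial := by
      rw [← Nat.choose_mul_factorial_mul_factorial hab, mul_assoc]
      exact h1.mul_right _
    exact absurd ((hp.out.dvd_factorial).1 h2) (by omega)
  · exact h h1

/-- All `m` base-`p` digits of `f = (p ^ m - 1) / e` equal `d = (p - 1) / e`, and `2 * d < p`, so
doubling `f` produces no carry. -/
lemma not_dvd_choose_two_of_one_mod {e d m : ℕ} (he : 2 < e) (hpe : p = e * d + 1) :
    ∀ f, p ^ m = e * f + 1 → ¬ p ∣ (2 * f).choose f := by
  induction m with
  | zero =>
    intro f hf
    have : f = 0 := by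
      have : e * f = 0 := by simpa using hf
      rcases Nat.mul_eq_zero.1 this with h | h <;> omega
    subst this
    simpa using hp.out.one_lt.ne'
  | succ m ih =>
    intro f hf
    obtain ⟨g, hg⟩ : e ∣ p ^ m - 1 := by
      have h1 : p ≡ 1 [MOD e] := by rw [hpe]; simp [Nat.ModEq]
      exact (Nat.modEq_iff_dvd' (Nat.one_le_pow _ _ hp.out.pos)).1 (by simpa using (h1.pow m).symm)
    have hg' : p ^ m = e * g + 1 := by
      have := Nat.one_le_pow m p hp.out.pos
      omega
    have hfg : f = p * g + d := by
      have : e * f = e * (p * g + d) := by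
        have : p ^ (m + 1) = e * (p * g + d) + 1 := by
          rw [pow_succ, hg']; nlinarith
        omega
      exact Nat.eq_of_mul_eq_mul_left (by omega) this
    have := not_dvd_choose_digit (p := p) (a := 2 * d) (b := d) (by omega) (by nlinarith) (ih g hg')
    rwa [show p * (2 * g) + 2 * d = 2 * f by rw [hfg]; ring, ← hfg] at this

/-- Two-digit blocks: if `c * f` has no carries over `f` in the block, divisibility fails. -/
lemma not_dvd_choose_of_two_digits {e d₁ d₀ c₁ c₀ c j : ℕ} (he : 0 < e)
    (hpe : p ^ 2 = e * (p * d₁ + d₀) + 1) (hc : c * (p * d₁ + d₀) = p * c₁ + c₀)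
    (h₁ : d₁ ≤ c₁) (hc₁ : c₁ < p) (h₀ : d₀ ≤ c₀) (hc₀ : c₀ < p) :
    ∀ f, p ^ (2 * j) = e * f + 1 → ¬ p ∣ (c * f).choose f := by
  induction j with
  | zero =>
    intro f hf
    have : f = 0 := by
      have : e * f = 0 := by simpa using hf
      rcases Nat.mul_eq_zero.1 this with h | h <;> omega
    subst this
    simpa using hp.out.one_lt.ne'
  | succ j ih =>
    intro f hf
    obtain ⟨g, hg⟩ : e ∣ p ^ (2 * j) - 1 := by
      have h1 : p ^ 2 ≡ 1 [MOD e] := by rw [hpe]; simp [Nat.ModEq]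
      rw [pow_mul]
      exact (Nat.modEq_iff_dvd' (Nat.one_le_pow _ _ (pow_pos hp.out.pos 2))).1
        (by simpa using (h1.pow j).symm)
    have hg' : p ^ (2 * j) = e * g + 1 := by
      have := Nat.one_le_pow (2 * j) p hp.out.pos
      omega
    have hfg : f = p * (p * g + d₁) + d₀ := by
      have : e * f = e * (p * (p * g + d₁) + d₀) := by
        have : p ^ (2 * (j + 1)) = e * (p * (p * g + d₁) + d₀) + 1 := by
          rw [mul_add, mul_one, pow_add, hg']
          linear_combination hpe
        omega
      exact Nat.eq_of_mul_eq_mul_left he this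
    have := not_dvd_choose_digit h₀ hc₀ (not_dvd_choose_digit h₁ hc₁ (ih g hg'))
    rwa [← hfg, show p * (p * (c * g) + c₁) + c₀ = c * f by
      rw [hfg]; linear_combination -hc] at this

end Lucas

/-! ### Excluded residue classes of `p`. -/

section NonExistence

variable {F : Type*} [Field F] [Fintype F] [DecidableEq F] {p m e f n k lam mu : ℕ}

lemma not_isPDS_of_one_mod [Fact p.Prime] [CharP F p] (hm : Fintype.card F = p ^ m)
    (hq : Fintype.card F = e * f + 1) (he : 2 < e) (hpe : p % e = 1) (hneg : (-1 : F) ^ f = 1) :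
    ¬ IsPDS (unityRoots F f) n k lam mu := fun h =>
  not_dvd_choose_two_of_one_mod (d := p / e) (m := m) he
    (by have := Nat.div_add_mod p e; omega) f (by rw [← hm, hq]) (h.dvd_choose_two hq hneg he)

lemma not_isPDS_eight_of_three_mod [Fact p.Prime] [CharP F p]
    (hm : Fintype.card F = p ^ (2 * m)) (hq : Fintype.card F = 8 * f + 1) (hpe : p % 8 = 3)
    (hneg : (-1 : F) ^ f = 1) : ¬ IsPDS (unityRoots F f) n k lam mu := fun h => by
  obtain ⟨t, rfl⟩ : ∃ t, p = 8 * t + 3 := ⟨p / 8, by omega⟩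
  -- For `p = 8t + 3`, `(p ^ 2 - 1) / 8` has digits `t` and `3t + 1`; doubling gives `2t` and `6t +
  -- 2`, without carry.
  refine not_dvd_choose_of_two_digits (p := 8 * t + 3) (e := 8) (d₁ := t) (d₀ := 3 * t + 1)
    (c₁ := 2 * t) (c₀ := 6 * t + 2) (c := 2) (j := m) (by omega) (by ring) (by ring) (by omega)
    (by omega) (by omega) (by omega) f (by rw [← hm, hq]) (h.dvd_choose_two hq hneg (by omega))

lemma not_isPDS_eight_of_five_mod [Fact p.Prime] [CharP F p]
    (hm : Fintype.card F = p ^ (2 * m)) (hq : Fintype.card F = 8 * f + 1) (hpe : p % 8 = 5)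
    (hneg : (-1 : F) ^ f = 1) : ¬ IsPDS (unityRoots F f) n k lam mu := fun h => by
  have h2 : (2 : F) ≠ 0 := fun h0 => by
    have := (CharP.cast_eq_zero_iff F p 2).1 (by exact_mod_cast h0)
    have := Nat.le_of_dvd (by omega) this
    omega
  obtain ⟨t, rfl⟩ : ∃ t, p = 8 * t + 5 := ⟨p / 8, by omega⟩
  -- For `p = 8t + 5` the digits are `t` and `5t + 3`, and doubling does carry. Tripling gives `3t +
  -- 1` and `7t + 4`, which still dominate the digits of `f`, so the third moment is used.
  refine not_dvd_choose_of_two_digits (p := 8 * t + 5) (e := 8) (d₁ := t) (d₀ := 5 * t + 3)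
    (c₁ := 3 * t + 1) (c₀ := 7 * t + 4) (c := 3) (j := m) (by omega) (by ring) (by ring)
    (by omega) (by omega) (by omega) (by omega) f (by rw [← hm, hq])
    (h.dvd_choose_three hq h2 hneg (by omega))

end NonExistence

/-! ### A Frobenius-invariant additive character. -/

section AdditiveCharacters

lemma isIntegral_addChar {G : Type*} [AddGroup G] [Fintype G] (ψ : AddChar G ℂ) (x : G) :
    IsIntegral ℤ (ψ x) := by
  refine IsIntegral.of_pow (Fintype.card_pos_iff.2 ⟨(0 : G)⟩) ?_
  rw [← AddChar.map_nsmul_eq_pow, card_nsmul_eq_zero, AddChar.map_zero_eq_one]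
  exact isIntegral_one

variable {F : Type*} [Field F] [Fintype F] {p : ℕ} [hp : Fact p.Prime] [CharP F p]

variable (F p) in
-- Compose a nontrivial character of the prime field with the trace, which is Galois invariant.
lemma exists_isPrimitive_frobenius_invariant :
    ∃ ψ : AddChar F ℂ, ψ.IsPrimitive ∧ ∀ x, ψ (x ^ p) = ψ x := by
  let _ : Algebra (ZMod p) F := ZMod.algebra F p
  have : NeZero p := ⟨hp.out.ne_zero⟩
  have hζ := Complex.isPrimitiveRoot_exp p hp.out.ne_zero
  let ψ₀ := AddChar.zmodChar p hζ.pow_eq_one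
  have hψ₀ : ψ₀.IsPrimitive := AddChar.zmodChar_primitive_of_primitive_root p hζ
  let ψ : AddChar F ℂ := ψ₀.compAddMonoidHom (Algebra.trace (ZMod p) F).toAddMonoidHom
  refine ⟨ψ, AddChar.IsPrimitive.of_ne_one ?_, fun x => ?_⟩
  · obtain ⟨a, ha⟩ : ∃ a, Algebra.trace (ZMod p) F a ≠ 0 := by
      by_contra! h
      exact Algebra.trace_ne_zero (ZMod p) F (LinearMap.ext h)
    rw [AddChar.ne_one_iff]
    exact ⟨a, fun h => ha ((hψ₀.zmod_char_eq_one_iff p _).1 h)⟩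
  · have := Algebra.trace_eq_of_algEquiv (FiniteField.frobeniusAlgEquivOfAlgebraic (ZMod p) F) x
    rw [FiniteField.coe_frobeniusAlgEquivOfAlgebraic] at this
    simp only [ZMod.card] at this
    simp only [ψ, AddChar.compAddMonoidHom_apply, LinearMap.toAddMonoidHom_coe]
    rw [this]

end AdditiveCharacters

/-! ### Difference counts by Fourier inversion. -/

section FourierInversion

variable {F : Type*} [Field F] [Fintype F] [DecidableEq F]

/-- The Fourier transform of the indicator function of a finite set. -/
noncomputable def charSum (ψ : AddChar F ℂ) (P : Finset F) (b : F) : ℂ := ∑ x ∈ P, ψ (b * x)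

variable {ψ : AddChar F ℂ}

lemma sum_charSum_mul (hψ : ψ.IsPrimitive) (P : Finset F) (g : F) :
    ∑ b, ψ (-(b * g)) * charSum ψ P b = if g ∈ P then (Fintype.card F : ℂ) else 0 := by
  simp only [charSum, Finset.mul_sum, ← AddChar.map_add_eq_mul]
  rw [Finset.sum_comm]
  have h1 (x : F) : ∑ b, ψ (-(b * g) + b * x) = if x = g then (Fintype.card F : ℂ) else 0 := by
    have := AddChar.sum_mulShift (x - g) hψ
    rw [Nat.cast_ite, Nat.cast_zero] at this
    simp only [sub_eq_zero] at this
    rw [← this]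
    exact Finset.sum_congr rfl fun b _ => by congr 1; ring
  simp only [h1]
  rw [Finset.sum_ite_eq']

lemma card_mul_diffCount (hψ : ψ.IsPrimitive) (P : Finset F) (g : F) :
    (Fintype.card F : ℂ) * diffCount P g =
      ∑ b, ψ (-(b * g)) * (charSum ψ P b * charSum ψ P (-b)) := by
  have h1 : ∀ b : F, ψ (-(b * g)) * (charSum ψ P b * charSum ψ P (-b)) =
      ∑ z ∈ P ×ˢ P, ψ (b * (z.1 - z.2 - g)) := fun b => by
    rw [charSum, charSum, Finset.sum_mul_sum, ← Finset.sum_product', Finset.mul_sum]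
    refine Finset.sum_congr rfl fun z _ => ?_
    rw [← AddChar.map_add_eq_mul, ← AddChar.map_add_eq_mul]
    congr 1; ring
  simp only [h1]
  rw [Finset.sum_comm]
  simp only [AddChar.sum_mulShift _ hψ, sub_eq_zero]
  rw [diffCount, Finset.card_filter]
  push_cast
  rw [Finset.mul_sum]
  exact Finset.sum_congr rfl fun z _ => by split_ifs <;> simp

/-- A symmetric set whose nontrivial character sums take two values has difference counts
depending only on membership. -/
lemma diffCount_eq_of_charSum (hψ : ψ.IsPrimitive) {P : Finset F} {r s : ℂ}
    (hsymm : ∀ b, charSum ψ P (-b) = charSum ψ P b)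
    (hrs : ∀ b, b ≠ 0 → charSum ψ P b = r ∨ charSum ψ P b = s) {g : F} (hg : g ≠ 0) :
    (Fintype.card F : ℂ) * diffCount P g =
      (#P - r) * (#P - s) + if g ∈ P then (Fintype.card F : ℂ) * (r + s) else 0 := by
  have h0 : charSum ψ P 0 = #P := by simp [charSum]
  -- Both values are roots of `X ^ 2 - (r + s) * X + r * s`, so the squared transform is affine in
  -- the transform, up to a correction at `b = 0`, where the transform is `#P`.
  have hsq (b : F) : charSum ψ P b * charSum ψ P (-b) =
      (r + s) * charSum ψ P b - r * s + if b = 0 then (#P - r) * (#P - s : ℂ) else 0 := by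
    rw [hsymm]
    split_ifs with hb
    · rw [hb, h0]; ring
    · rcases hrs b hb with h | h <;> rw [h] <;> ring
  have h2 : ∑ b, ψ (-(b * g)) = 0 := by
    have := AddChar.sum_mulShift (-g) hψ
    rw [if_neg (neg_ne_zero.2 hg), Nat.cast_zero] at this
    rw [← this]
    exact Finset.sum_congr rfl fun b _ => by congr 1; ring
  rw [card_mul_diffCount hψ]
  calc ∑ b, ψ (-(b * g)) * (charSum ψ P b * charSum ψ P (-b))
      = ∑ b, ((r + s) * (ψ (-(b * g)) * charSum ψ P b) - r * s * ψ (-(b * g)) +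
          if b = 0 then (#P - r) * (#P - s : ℂ) else 0) := by
        refine Finset.sum_congr rfl fun b _ => ?_
        rw [hsq]
        split_ifs with hb
        · subst hb; simp
        · ring
    _ = _ := by
        rw [Finset.sum_add_distrib, Finset.sum_sub_distrib, ← Finset.mul_sum, ← Finset.mul_sum,
          sum_charSum_mul hψ, h2, Finset.sum_ite_eq']
        simp only [mem_univ, if_true]
        split_ifs <;> ring

end FourierInversion

/-! ### Exponential sums of `b * x ^ (p + 1)` and Gaussian periods. -/

section HermitianSums

lemma neg_one_pow_mul_eq_one {F : Type*} [Field F] {p : ℕ} [hp : Fact p.Prime] [CharP F p]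
    (k : ℕ) : (-1 : F) ^ ((p - 1) * k) = 1 := by
  rcases hp.out.eq_two_or_odd' with rfl | h
  · rw [CharTwo.neg_eq, one_pow]
  · rw [pow_mul, Even.neg_one_pow, one_pow]
    obtain ⟨t, rfl⟩ := h
    exact ⟨t, by omega⟩

lemma sum_eq_zero_add_sum_units {F R : Type*} [Field F] [Fintype F] [DecidableEq F] [CommRing R]
    (φ : F → R) : ∑ x, φ x = φ 0 + ∑ u : Fˣ, φ u := by
  rw [← Finset.add_sum_erase _ _ (mem_univ (0 : F))]
  congr 1
  symm
  refine Finset.sum_bij (fun u _ => (u : F)) ?_ ?_ ?_ (fun _ _ => rfl)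
  · intro u _; simp
  · intro u _ v _ h; exact Units.ext h
  · intro x hx
    exact ⟨Units.mk0 x (by simpa using hx), mem_univ _, rfl⟩

variable {F : Type*} [Field F] [Fintype F] {p : ℕ}

/-- The exponential sum of the form `x ↦ b * x ^ (p + 1)`. -/
noncomputable def hermitianSum (ψ : AddChar F ℂ) (p : ℕ) (b : F) : ℂ := ∑ x, ψ (b * x ^ (p + 1))

lemma hermitianSum_mul_pow (ψ : AddChar F ℂ) (b : F) {w : F} (hw : w ≠ 0) :
    hermitianSum ψ p (b * w ^ (p + 1)) = hermitianSum ψ p b := by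
  rw [hermitianSum, hermitianSum, ← Equiv.sum_comp (Equiv.mulLeft₀ w hw) fun x => ψ (b * x ^ (p + 1))]
  refine Finset.sum_congr rfl fun x _ => ?_
  rw [Equiv.mulLeft₀_apply, mul_pow, mul_assoc]

/-- As `e ∣ p + 1`, every `u ^ (p + 1)` lies in the group of `f`-th roots of unity, so averaging
over that group turns each unit's contribution into the same Gaussian period. -/
lemma mul_one_add_charSum [DecidableEq F] {ψ : AddChar F ℂ} {e f c : ℕ} (hq : Fintype.card F = e * f + 1) (hc : p + 1 = e * c)
    (b : F) : (f : ℂ) * (1 + e * charSum ψ (unityRoots F f) b) =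
      ∑ y ∈ unityRoots F f, hermitianSum ψ p (b * y) := by
  have h1 (y : F) : hermitianSum ψ p (b * y) = 1 + ∑ u : Fˣ, ψ (b * (y * (u : F) ^ (p + 1))) := by
    rw [hermitianSum, sum_eq_zero_add_sum_units]
    simp [mul_assoc]
  have h2 (u : Fˣ) : ∑ y ∈ unityRoots F f, ψ (b * (y * (u : F) ^ (p + 1))) =
      charSum ψ (unityRoots F f) b := by
    refine sum_unityRoots_mul (fun y => ψ (b * y)) (pow_ne_zero _ u.ne_zero) ?_
    rw [mem_unityRoots, ← pow_mul, hc, show e * c * f = e * f * c by ring, pow_mul,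
      pow_eq_one_of_card_eq hq u.ne_zero, one_pow]
  simp only [h1]
  rw [Finset.sum_add_distrib, Finset.sum_comm]
  simp only [h2]
  rw [Finset.sum_const, Finset.sum_const, card_unityRoots hq, Finset.card_univ,
    Fintype.card_units, hq, Nat.add_sub_cancel]
  simp only [nsmul_eq_mul]
  push_cast
  ring

variable [hp : Fact p.Prime] [CharP F p] {ψ : AddChar F ℂ} {g j : ℕ}

variable [DecidableEq F]

lemma hermitianSum_neg (hg : Fintype.card F = (p + 1) * ((p - 1) * g) + 1) (b : F) :
    hermitianSum ψ p (-b) = hermitianSum ψ p b := by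
  obtain ⟨w, hw⟩ := (mem_unityRoots_iff_exists_pow hg).1
    (mem_unityRoots.2 (neg_one_pow_mul_eq_one (F := F) (p := p) g))
  rw [← hermitianSum_mul_pow ψ b w.ne_zero, ← hw, mul_neg_one]

/-- The radical of the bilinear form attached to `x ↦ b * x ^ (p + 1)`. -/
def hermitianRadical (p : ℕ) (b : F) : Finset F := {x | b ^ p * x ^ p ^ 2 + b * x = 0}

/-- On the radical `t = b * x ^ (p + 1)` satisfies `t ^ p = -t`. For odd `p`, `ψ t` is then both a
square root and a `p`-th root of unity. For `p = 2`, `t` is `0` or `1`, and `1 = w ^ 2 + w` with `w`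
a primitive cube root of unity, where `ψ (w ^ 2) = ψ w`. -/
lemma apply_eq_one_of_mem_radical (hg : Fintype.card F = (p + 1) * ((p - 1) * g) + 1)
    (hfrob : ∀ x, ψ (x ^ p) = ψ x) {b x : F} (hx : x ∈ hermitianRadical p b) :
    ψ (b * x ^ (p + 1)) = 1 := by
  have hx' : b ^ p * x ^ p ^ 2 + b * x = 0 := by simpa [hermitianRadical] using hx
  set t := b * x ^ (p + 1) with ht
  have h1 : t ^ p = -t := by
    rw [ht, mul_pow, ← pow_mul, show (p + 1) * p = p ^ 2 + p by ring, pow_add, ← mul_assoc,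
      eq_neg_of_add_eq_zero_left hx']
    ring
  rcases hp.out.eq_two_or_odd' with rfl | ⟨k, hk⟩
  · rw [CharTwo.neg_eq] at h1
    have h2 : t * (t - 1) = 0 := by linear_combination h1
    rcases mul_eq_zero.1 h2 with h3 | h3
    · rw [h3, AddChar.map_zero_eq_one]
    · obtain ⟨w, hw1, hw⟩ : ∃ w : F, w ≠ 1 ∧ w ∈ unityRoots F 3 := by
        have hc := card_unityRoots (F := F) (e := g) (f := 3) (by rw [hg]; ring)
        by_contra! h
        have : unityRoots F 3 ⊆ {1} := fun w hw => by
          by_contra hne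
          exact h w (by simpa using hne) hw
        have := Finset.card_le_card this
        simp [hc] at this
      have hw3 : w ^ 3 = 1 := mem_unityRoots.1 hw
      have h4 : w ^ 2 + w + 1 = 0 := by
        apply mul_left_cancel₀ (sub_ne_zero.2 hw1)
        linear_combination hw3
      have h20 : (2 : F) = 0 := CharTwo.two_eq_zero
      have h5 : t = w ^ 2 + w := by linear_combination h3 - h4 + h20
      rw [h5, AddChar.map_add_eq_mul, hfrob, ← AddChar.map_add_eq_mul]
      rw [CharTwo.add_self_eq_zero, AddChar.map_zero_eq_one]
  · have h2 : ψ t * ψ t = 1 := by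
      have := hfrob t
      rw [h1] at this
      nth_rewrite 1 [← this]
      rw [← AddChar.map_add_eq_mul, neg_add_cancel, AddChar.map_zero_eq_one]
    have h3 : ψ t ^ p = 1 := by
      rw [← AddChar.map_nsmul_eq_pow, nsmul_eq_mul, CharP.cast_eq_zero, zero_mul,
        AddChar.map_zero_eq_one]
    rw [hk, pow_succ, pow_mul, pow_two, h2, one_pow, one_mul] at h3
    exact h3

/-- Substituting `x + z` for the first variable cancels the pure `z` term; Frobenius invariance
makes the rest additive in `z ^ p`, and summing over `z` leaves only `x` in the radical. -/
lemma hermitianSum_mul_neg (hg : Fintype.card F = (p + 1) * ((p - 1) * g) + 1)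
    (hψ : ψ.IsPrimitive) (hfrob : ∀ x, ψ (x ^ p) = ψ x) (b : F) :
    hermitianSum ψ p b * hermitianSum ψ p (-b) =
      Fintype.card F * #(hermitianRadical p b) := by
  have h1 : hermitianSum ψ p b * hermitianSum ψ p (-b) =
      ∑ z : F, ∑ x : F, ψ (b * (x + z) ^ (p + 1)) * ψ (-b * z ^ (p + 1)) := by
    rw [mul_comm, hermitianSum, hermitianSum, Finset.sum_mul]
    refine Finset.sum_congr rfl fun z _ => ?_
    rw [Finset.mul_sum, ← Equiv.sum_comp (Equiv.addRight z)]
    exact Finset.sum_congr rfl fun x _ => by rw [Equiv.coe_addRight, mul_comm]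
  have h2 (x z : F) : ψ (b * (x + z) ^ (p + 1)) * ψ (-b * z ^ (p + 1)) =
      ψ (b * x ^ (p + 1)) * ψ (z ^ p * (b ^ p * x ^ p ^ 2 + b * x)) := by
    have h3 : b * (x + z) ^ (p + 1) + -b * z ^ (p + 1) =
        b * x ^ (p + 1) + (b * x ^ p * z + z ^ p * (b * x)) := by
      rw [pow_succ, add_pow_char]; ring
    have h4 : z ^ p * (b ^ p * x ^ p ^ 2) = (b * x ^ p * z) ^ p := by
      rw [mul_pow, mul_pow, ← pow_mul, pow_two]; ring
    rw [← AddChar.map_add_eq_mul, h3, mul_add, h4]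
    simp only [AddChar.map_add_eq_mul, hfrob]
  have h5 (c : F) : ∑ z : F, ψ (z ^ p * c) = if c = 0 then (Fintype.card F : ℂ) else 0 := by
    have h := AddChar.sum_mulShift c hψ
    rw [Nat.cast_ite, Nat.cast_zero] at h
    rw [← h]
    exact (bijective_frobenius F p).sum_comp (fun z => ψ (z * c))
  rw [h1, Finset.sum_comm]
  simp only [h2, ← Finset.mul_sum, h5, mul_ite, mul_zero]
  rw [← Finset.sum_filter, ← hermitianRadical, Finset.sum_congr rfl
    (g := fun _ => (Fintype.card F : ℂ)) fun x hx => by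
      rw [apply_eq_one_of_mem_radical hg hfrob hx, one_mul]]
  rw [Finset.sum_const, nsmul_eq_mul, mul_comm]

/-- Nonzero elements solve `b ^ (p - 1) * x ^ (p ^ 2 - 1) = -1`. Since `p ^ 2 - 1` divides `q - 1`,
they form either the empty set or a coset of the `(p ^ 2 - 1)`-th roots of unity. -/
lemma card_hermitianRadical (hg : Fintype.card F = (p + 1) * ((p - 1) * g) + 1) {b : F}
    (hb : b ≠ 0) :
    #(hermitianRadical p b) = if b ^ ((p - 1) * g) = (-1) ^ g then p ^ 2 else 1 := by
  have hp1 : p - 1 + 1 = p := Nat.sub_add_cancel hp.out.one_le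
  have hg' : Fintype.card F = ((p + 1) * (p - 1)) * g + 1 := by rw [hg]; ring
  have hpp : (p + 1) * (p - 1) + 1 = p ^ 2 := by
    obtain ⟨r, rfl⟩ : ∃ r, p = r + 1 := ⟨p - 1, hp1.symm⟩
    simp only [Nat.add_sub_cancel]; ring
  have hN : (p + 1) * (p - 1) ≠ 0 := (ne_zero_of_card_eq hg').1
  have hmem (x : F) (hx : x ≠ 0) :
      x ∈ hermitianRadical p b ↔ b ^ (p - 1) * x ^ ((p + 1) * (p - 1)) = -1 := by
    have h1 : b ^ p * x ^ p ^ 2 + b * x =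
        (b * x) * (b ^ (p - 1) * x ^ ((p + 1) * (p - 1)) + 1) := by
      rw [← hpp, pow_succ x, ← hp1, pow_succ b, hp1]; ring
    simp only [hermitianRadical, mem_filter, mem_univ, true_and]
    rw [h1, mul_eq_zero, or_iff_right (mul_ne_zero hb hx), add_eq_zero_iff_eq_neg]
  have hb' : b ^ (p - 1) ≠ 0 := pow_ne_zero _ hb
  have hsolv : (∃ u : Fˣ, b ^ (p - 1) * (u : F) ^ ((p + 1) * (p - 1)) = -1) ↔
      b ^ ((p - 1) * g) = (-1) ^ g := by
    have h2 := mem_unityRoots_iff_exists_pow hg' (x := -(b ^ (p - 1))⁻¹)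
    rw [mem_unityRoots] at h2
    have h3 : (-(b ^ (p - 1))⁻¹) ^ g = 1 ↔ b ^ ((p - 1) * g) = (-1) ^ g := by
      rw [neg_pow, inv_pow, ← pow_mul, mul_inv_eq_one₀ (pow_ne_zero _ hb), eq_comm]
    rw [← h3, h2]
    refine exists_congr fun u => ?_
    rw [← mul_right_inj' hb' (b := -(b ^ (p - 1))⁻¹), mul_neg, mul_inv_cancel₀ hb', eq_comm]
  have h0 : (0 : F) ∈ hermitianRadical p b := by
    simp [hermitianRadical, hp.out.ne_zero]
  split_ifs with hs
  · obtain ⟨u, hu⟩ := hsolv.2 hs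
    have h4 : hermitianRadical p b =
        insert 0 ((unityRoots F ((p + 1) * (p - 1))).image (fun t => (u : F) * t)) := by
      ext x
      rw [mem_insert, mem_image]
      by_cases hx : x = 0
      · simp [hx, h0]
      rw [hmem x hx, or_iff_right hx]
      constructor
      · intro h
        refine ⟨(u : F)⁻¹ * x, ?_, by simp⟩
        rw [mem_unityRoots, mul_pow, inv_pow,
          inv_mul_eq_one₀ (pow_ne_zero _ u.ne_zero)]
        exact mul_left_cancel₀ hb' (hu.trans h.symm)
      · rintro ⟨t, ht, rfl⟩
        rw [mul_pow, mem_unityRoots.1 ht, mul_one, hu]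
    rw [h4, card_insert_of_notMem, card_image_of_injective _ (mul_right_injective₀ u.ne_zero),
      card_unityRoots (e := g) (by rw [hg', mul_comm]), hpp]
    rw [mem_image]
    rintro ⟨t, ht, h⟩
    rcases mul_eq_zero.1 h with h | h
    · exact u.ne_zero h
    · exact zero_notMem_unityRoots hN (h ▸ ht)
  · rw [card_eq_one]
    refine ⟨0, Finset.eq_singleton_iff_unique_mem.2 ⟨h0, fun x hx => ?_⟩⟩
    by_contra hx0
    exact hs (hsolv.1 ⟨Units.mk0 x hx0, (hmem x hx0).1 hx⟩)

/-- A complex number that is `1` modulo `N ≥ 3` and squares to `T ^ 2`, with `T` an integer that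
is `1` modulo `N`, equals `T`. -/
lemma eq_intCast_of_sq_eq {N : ℕ} (hN : 2 < N) {S η : ℂ} {T t : ℤ} (hη : IsIntegral ℤ η)
    (hS : S = 1 + N * η) (hT : T = 1 + N * t) (h : S * S = T * T) : S = T := by
  rcases mul_self_eq_mul_self_iff.1 h with h | h
  · exact h
  exfalso
  have hN0 : (N : ℂ) ≠ 0 := by exact_mod_cast (by omega : N ≠ 0)
  -- If `S = -T`, then `-2 / N` would be an algebraic integer, hence an integer.
  have h1 : N * (η + t) = ((-2 : ℤ) : ℂ) := by
    have : (T : ℂ) = 1 + N * t := by exact_mod_cast hT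
    push_cast
    linear_combination -hS + h - this
  have h2 : η + t = algebraMap ℚ ℂ (-2 / N) := by
    rw [eq_ratCast]
    push_cast
    rw [eq_div_iff hN0, mul_comm]
    simpa using h1
  have h3 : IsIntegral ℤ (η + t : ℂ) := hη.add isIntegral_algebraMap
  rw [h2, isIntegral_algebraMap_iff (algebraMap ℚ ℂ).injective,
    IsIntegrallyClosed.isIntegral_iff] at h3
  obtain ⟨y, hy⟩ := h3
  have h4 : (N : ℤ) * y = -2 := by
    have hN0' : (N : ℚ) ≠ 0 := by exact_mod_cast (by omega : N ≠ 0)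
    rw [eq_intCast, eq_div_iff hN0'] at hy
    have : (y * N : ℤ) = -2 := by exact_mod_cast hy
    linarith
  have h5 : (N : ℤ) ∣ 2 := ⟨-y, by linarith⟩
  have := Int.le_of_dvd (by norm_num) h5
  omega

lemma exists_neg_pow_eq (p i : ℕ) : ∃ t : ℤ, (-(p : ℤ)) ^ i = 1 + ((p + 1 : ℕ) : ℤ) * t := by
  have h : (-(p : ℤ)) ≡ 1 [ZMOD ((p + 1 : ℕ) : ℤ)] := by
    rw [Int.modEq_iff_dvd]; exact ⟨1, by push_cast; ring⟩
  have h2 := (h.pow i).symm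
  rw [one_pow, Int.modEq_iff_dvd] at h2
  obtain ⟨t, ht⟩ := h2
  exact ⟨t, by linarith⟩

/-- Evaluation of the exponential sum of a Hermitian-type form. -/
lemma hermitianSum_eq (hj : Fintype.card F = p ^ (2 * j))
    (hg : Fintype.card F = (p + 1) * ((p - 1) * g) + 1)
    (hψ : ψ.IsPrimitive) (hfrob : ∀ x, ψ (x ^ p) = ψ x) {b : F} (hb : b ≠ 0) :
    hermitianSum ψ p b =
      if b ^ ((p - 1) * g) = (-1) ^ g then (-(p : ℂ)) ^ (j + 1) else (-(p : ℂ)) ^ j := by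
  have h1 := hermitianSum_mul_neg hg hψ hfrob b
  rw [hermitianSum_neg hg, card_hermitianRadical hg hb, hj] at h1
  -- The nonzero `x` fall into fibres of size `p + 1`, so the sum is `1` modulo `p + 1`, as is every
  -- power of `-p`; this selects the sign.
  have h2 : hermitianSum ψ p b =
      1 + ((p + 1 : ℕ) : ℂ) * ∑ x ∈ unityRoots F ((p - 1) * g), ψ (b * x) := by
    rw [← sum_units_pow hg (fun x => ψ (b * x)), hermitianSum, sum_eq_zero_add_sum_units]
    simp
  have hint : IsIntegral ℤ (∑ x ∈ unityRoots F ((p - 1) * g), ψ (b * x)) :=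
    IsIntegral.sum _ fun x _ => isIntegral_addChar ψ _
  have hlt : 2 < p + 1 := by have := hp.out.two_le; omega
  split_ifs at h1 ⊢ with hs
  · obtain ⟨t, ht⟩ := exists_neg_pow_eq p (j + 1)
    have := eq_intCast_of_sq_eq hlt hint h2 ht (by
      rw [h1]; push_cast
      rw [← mul_pow, neg_mul_neg, ← pow_two, ← pow_mul, ← pow_add]; ring)
    rw [this]; push_cast; rfl
  · obtain ⟨t, ht⟩ := exists_neg_pow_eq p j
    have := eq_intCast_of_sq_eq hlt hint h2 ht (by
      rw [h1]; push_cast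
      rw [← mul_pow, neg_mul_neg, ← pow_two, ← pow_mul, mul_one])
    rw [this]; push_cast; rfl

/-- A nonempty fibre of `y ↦ (b * y) ^ d` is a coset of the `d`-th roots of unity. -/
lemma card_filter_mul_pow_eq {f d : ℕ} (hd : d ∣ f) (hf : f ≠ 0) (z : F) {b : F} (hb : b ≠ 0)
    (hcard : #(unityRoots F d) = d) :
    #{y ∈ unityRoots F f | (b * y) ^ d = z} = 0 ∨ #{y ∈ unityRoots F f | (b * y) ^ d = z} = d := by
  by_cases h : ∃ y₀ ∈ unityRoots F f, (b * y₀) ^ d = z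
  · right
    obtain ⟨y₀, hy₀, h₀⟩ := h
    have hy : y₀ ≠ 0 := fun h0 => zero_notMem_unityRoots hf (h0 ▸ hy₀)
    rw [mem_unityRoots] at hy₀
    have hz : b ^ d * y₀ ^ d = z := by rw [← h₀, mul_pow]
    refine Eq.trans ?_ hcard
    refine Finset.card_bij' (fun y _ => y * y₀⁻¹) (fun t _ => t * y₀) ?_ ?_ ?_ ?_
    · intro y hy'
      obtain ⟨-, h1⟩ := mem_filter.1 hy'
      rw [mul_pow, ← hz] at h1
      rw [mem_unityRoots, mul_pow, inv_pow, mul_inv_eq_one₀ (pow_ne_zero _ hy)]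
      exact mul_left_cancel₀ (pow_ne_zero _ hb) h1
    · intro t ht
      rw [mem_unityRoots] at ht
      rw [mem_filter, mem_unityRoots, mul_pow, mul_pow, mul_pow, ht, one_mul, hz, hy₀, mul_one]
      obtain ⟨c, rfl⟩ := hd
      exact ⟨by rw [pow_mul, ht, one_pow], rfl⟩
    · intro y _; simp [hy]
    · intro t _; simp [hy]
  · left
    rw [card_eq_zero, filter_eq_empty_iff]
    push Not at h
    exact h

/-- In the semiprimitive case the Gaussian periods of order `e` take two values. -/
lemma charSum_unityRoots {e f c : ℕ} (hq : Fintype.card F = e * f + 1) (hc : p + 1 = e * c)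
    (hj : Fintype.card F = p ^ (2 * j))
    (hg : Fintype.card F = (p + 1) * ((p - 1) * g) + 1)
    (hψ : ψ.IsPrimitive) (hfrob : ∀ x, ψ (x ^ p) = ψ x) {b : F} (hb : b ≠ 0) :
    charSum ψ (unityRoots F f) b = ((-(p : ℂ)) ^ j - 1) / e ∨
    charSum ψ (unityRoots F f) b = ((-(p : ℂ)) ^ j - 1) / e - (-(p : ℂ)) ^ j := by
  obtain ⟨he, hf⟩ := ne_zero_of_card_eq hq
  have he' : (e : ℂ) ≠ 0 := by exact_mod_cast he
  have hf' : (f : ℂ) ≠ 0 := by exact_mod_cast hf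
  have hfd : f = c * ((p - 1) * g) := by
    apply Nat.eq_of_mul_eq_mul_left (Nat.pos_of_ne_zero he)
    rw [← mul_assoc, ← hc]
    omega
  have h1 := mul_one_add_charSum (ψ := ψ) hq hc b
  have h2 : ∀ y ∈ unityRoots F f, hermitianSum ψ p (b * y) =
      (-(p : ℂ)) ^ j - if (b * y) ^ ((p - 1) * g) = (-1) ^ g then
        ((p : ℂ) + 1) * (-(p : ℂ)) ^ j else 0 := fun y hy => by
    have hy : y ≠ 0 := fun h0 => zero_notMem_unityRoots hf (h0 ▸ hy)
    rw [hermitianSum_eq hj hg hψ hfrob (mul_ne_zero hb hy)]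
    split_ifs <;> ring
  rw [Finset.sum_congr rfl h2, Finset.sum_sub_distrib, Finset.sum_const, ← Finset.sum_filter,
    Finset.sum_const, card_unityRoots hq, nsmul_eq_mul, nsmul_eq_mul] at h1
  -- The exceptional value of the exponential sum occurs for none of the `y`, or for exactly `(p -
  -- 1) * g` of them.
  rcases card_filter_mul_pow_eq (Dvd.intro_left c hfd.symm) hf ((-1) ^ g) hb
    (card_unityRoots hg) with h3 | h3
  · left
    rw [h3, Nat.cast_zero, zero_mul, sub_zero] at h1
    have := mul_left_cancel₀ hf' h1
    rw [eq_div_iff he']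
    linear_combination this
  · right
    rw [h3] at h1
    have h4 : (((p - 1) * g : ℕ) : ℂ) * ((p : ℂ) + 1) = f * e := by
      have : (p - 1) * g * (p + 1) = f * e := by
        rw [mul_comm _ (p + 1), mul_comm f]; omega
      exact_mod_cast this
    have h5 : (f : ℂ) * (1 + e * charSum ψ (unityRoots F f) b) =
        f * ((-(p : ℂ)) ^ j - e * (-(p : ℂ)) ^ j) := by
      rw [h1]; linear_combination (-(-(p : ℂ)) ^ j) * h4
    have := mul_left_cancel₀ hf' h5
    apply mul_left_cancel₀ he'
    rw [mul_sub, mul_div_cancel₀ _ he']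
    linear_combination this

end HermitianSums

/-! ### Existence and parameters when `e ∣ p + 1` and `q = p ^ (2 * j)`. -/

section Semiprimitive

lemma card_eq_sq {F : Type*} [Fintype F] {p j : ℕ} (hj : Fintype.card F = p ^ (2 * j)) :
    (Fintype.card F : ℤ) = ((-(p : ℤ)) ^ j) ^ 2 := by
  rw [hj, ← pow_mul, mul_comm j 2, pow_mul, pow_mul, neg_sq]
  push_cast; rfl

variable {F : Type*} [Field F] [Fintype F] {p e f c j : ℕ}

lemma exists_card_eq_mul (hj : Fintype.card F = p ^ (2 * j)) :
    ∃ g, Fintype.card F = (p + 1) * ((p - 1) * g) + 1 := by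
  obtain ⟨g, hg⟩ : (p ^ 2 - 1) ∣ (p ^ 2) ^ j - 1 := Nat.sub_one_dvd_pow_sub_one _ _
  refine ⟨g, ?_⟩
  rw [← pow_mul, ← hj, show p ^ 2 - 1 = (p + 1) * (p - 1) by
    simpa using Nat.sq_sub_sq p 1] at hg
  have := Fintype.card_pos (α := F)
  rw [← mul_assoc]
  omega

variable [DecidableEq F]

lemma exists_ne_zero_notMem_unityRoots (hq : Fintype.card F = e * f + 1) (he : 1 < e) :
    ∃ a : F, a ≠ 0 ∧ a ∉ unityRoots F f := by
  by_contra! h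
  have hs : (univ : Finset F) ⊆ insert 0 (unityRoots F f) := fun x _ => by
    rw [mem_insert]
    by_cases hx : x = 0
    · exact Or.inl hx
    · exact Or.inr (h x hx)
  have h1 := (Finset.card_le_card hs).trans (Finset.card_insert_le _ _)
  rw [card_unityRoots hq, Finset.card_univ, hq] at h1
  have := Nat.pos_of_ne_zero (ne_zero_of_card_eq hq).2
  nlinarith

variable [hp : Fact p.Prime] [CharP F p]

/-- Difference counts of the `e`-th powers when `e ∣ p + 1` and `q = p ^ (2 * j)`. -/
lemma sq_mul_diffCount_unityRoots (hq : Fintype.card F = e * f + 1) (hc : p + 1 = e * c)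
    (hj : Fintype.card F = p ^ (2 * j)) {a : F} (ha : a ≠ 0) :
    (e : ℤ) ^ 2 * diffCount (unityRoots F f) a =
      ((-(p : ℤ)) ^ j - 1) * ((-(p : ℤ)) ^ j - 1 + e) +
        if a ∈ unityRoots F f then
          2 * e * ((-(p : ℤ)) ^ j - 1) - e ^ 2 * (-(p : ℤ)) ^ j else 0 := by
  obtain ⟨g, hg⟩ := exists_card_eq_mul hj
  obtain ⟨ψ, hψ, hfrob⟩ := exists_isPrimitive_frobenius_invariant F p
  obtain ⟨he, hf⟩ := ne_zero_of_card_eq hq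
  have he' : (e : ℂ) ≠ 0 := by exact_mod_cast he
  have hfd : f = (p - 1) * (g * c) := by
    apply Nat.eq_of_mul_eq_mul_left (Nat.pos_of_ne_zero he)
    rw [show e * ((p - 1) * (g * c)) = (e * c) * ((p - 1) * g) by ring, ← hc]
    omega
  have hneg : (-1 : F) ∈ unityRoots F f := by
    rw [mem_unityRoots, hfd]; exact neg_one_pow_mul_eq_one _
  have hsymm (b : F) : charSum ψ (unityRoots F f) (-b) = charSum ψ (unityRoots F f) b := by
    rw [charSum, charSum, ← sum_unityRoots_mul _ (neg_ne_zero.2 one_ne_zero) hneg]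
    simp
  have key := diffCount_eq_of_charSum hψ hsymm
    (fun b hb => charSum_unityRoots hq hc hj hg hψ hfrob hb) ha
  have hσ : (Fintype.card F : ℂ) = ((-(p : ℂ)) ^ j) ^ 2 := by exact_mod_cast card_eq_sq hj
  have hσ0 : (-(p : ℂ)) ^ j ≠ 0 :=
    pow_ne_zero _ (neg_ne_zero.2 (by exact_mod_cast hp.out.ne_zero))
  have hfσ : (f : ℂ) = (((-(p : ℂ)) ^ j) ^ 2 - 1) / e := by
    rw [eq_div_iff he', ← hσ, hq]; push_cast; ring
  rw [card_unityRoots hq, hσ, hfσ] at key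
  have goal : (e : ℂ) ^ 2 * diffCount (unityRoots F f) a =
      ((-(p : ℂ)) ^ j - 1) * ((-(p : ℂ)) ^ j - 1 + e) +
        if a ∈ unityRoots F f then
          2 * e * ((-(p : ℂ)) ^ j - 1) - e ^ 2 * (-(p : ℂ)) ^ j else 0 := by
    -- With `q = σ ^ 2` and `f = (σ ^ 2 - 1) / e` the identity is rational in `σ`; the common factor
    -- `σ ^ 2` cancels.
    generalize (-(p : ℂ)) ^ j = σ at key hσ0 ⊢
    apply mul_left_cancel₀ (pow_ne_zero 2 hσ0)
    split_ifs at key ⊢ <;> field_simp at key <;> linear_combination key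
  exact_mod_cast goal

lemma IsPDS.semiprimitive_parameters {n k lam mu : ℕ} (hq : Fintype.card F = e * f + 1)
    (he : 1 < e) (hc : p + 1 = e * c) (hj : Fintype.card F = p ^ (2 * j))
    (h : IsPDS (unityRoots F f) n k lam mu) :
    n = Fintype.card F ∧ k = f ∧
    (e : ℤ) ^ 2 * mu = ((-(p : ℤ)) ^ j - 1) * ((-(p : ℤ)) ^ j - 1 + e) ∧
    (e : ℤ) ^ 2 * lam = ((-(p : ℤ)) ^ j - 1) * ((-(p : ℤ)) ^ j - 1 + e) +
      (2 * e * ((-(p : ℤ)) ^ j - 1) - e ^ 2 * (-(p : ℤ)) ^ j) := by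
  have hf := (ne_zero_of_card_eq hq).2
  obtain ⟨hn, hk, hcount⟩ := (isPDS_iff_diffCount (zero_notMem_unityRoots hf)).1 h
  obtain ⟨a, ha0, ha⟩ := exists_ne_zero_notMem_unityRoots hq he
  have h1 : (1 : F) ∈ unityRoots F f := by simp
  have ha' := sq_mul_diffCount_unityRoots hq hc hj ha0
  have h1' := sq_mul_diffCount_unityRoots hq hc hj (one_ne_zero (α := F))
  rw [hcount a ha0, if_neg ha, if_neg ha, add_zero] at ha'
  rw [hcount 1 one_ne_zero, if_pos h1, if_pos h1] at h1'
  exact ⟨hn.symm, by rw [← hk, card_unityRoots hq], ha', h1'⟩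

lemma exists_isPDS_of_semiprimitive (hq : Fintype.card F = e * f + 1)
    (he : 1 < e) (hc : p + 1 = e * c) (hj : Fintype.card F = p ^ (2 * j)) :
    ∃ n k lam mu, IsPDS (unityRoots F f) n k lam mu := by
  obtain ⟨he0, hf⟩ := ne_zero_of_card_eq hq
  obtain ⟨a, ha0, ha⟩ := exists_ne_zero_notMem_unityRoots hq he
  have h1 : (1 : F) ∈ unityRoots F f := by simp
  refine ⟨_, _, diffCount (unityRoots F f) 1, diffCount (unityRoots F f) a,
    (isPDS_iff_diffCount (zero_notMem_unityRoots hf)).2 ⟨rfl, rfl, fun g hg => ?_⟩⟩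
  have he2 : (e : ℤ) ^ 2 ≠ 0 := pow_ne_zero _ (by exact_mod_cast he0)
  have hg' := sq_mul_diffCount_unityRoots hq hc hj hg
  zify
  apply mul_left_cancel₀ he2
  rw [hg']
  split_ifs with hgP
  · rw [sq_mul_diffCount_unityRoots hq hc hj one_ne_zero, if_pos h1]
  · rw [sq_mul_diffCount_unityRoots hq hc hj ha0, if_neg ha]

/-- A proper cyclotomic partial difference set contains `-1`. -/
lemma IsProperPDS.neg_one_pow_eq_one {n k lam mu : ℕ} (hq : Fintype.card F = e * f + 1)
    (h : IsProperPDS (unityRoots F f) n k lam mu) : (-1 : F) ^ f = 1 :=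
  mem_unityRoots.1 (h.neg_mem (zero_notMem_unityRoots (ne_zero_of_card_eq hq).2) (by simp))

end Semiprimitive

/-! ### Quadratic forms and descent at `p`. -/

section Representations

/-- Descent for a form `x ^ 2 + D * y ^ 2` that is anisotropic modulo `p`. -/
lemma eq_zero_of_descent {p : ℕ} (hp : p ≠ 0) {n D : ℤ} (hn : 0 ≤ n) (hD : n < D)
    (h : ∀ x y : ℤ, n * p ^ 2 ∣ x ^ 2 + D * y ^ 2 → (p : ℤ) ∣ x ∧ (p : ℤ) ∣ y) :
    ∀ (j : ℕ) (x y : ℤ), n * p ^ (2 * j) = x ^ 2 + D * y ^ 2 → y = 0 := by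
  have hp' : (p : ℤ) ≠ 0 := by exact_mod_cast hp
  intro j
  induction j with
  | zero =>
    intro x y hxy
    by_contra hy
    have : 0 < y ^ 2 := by positivity
    rw [mul_zero, pow_zero, mul_one] at hxy
    nlinarith [sq_nonneg x]
  | succ j ih =>
    intro x y hxy
    obtain ⟨⟨x', rfl⟩, ⟨y', rfl⟩⟩ := h x y ⟨p ^ (2 * j), by rw [← hxy]; ring⟩
    rw [ih x' y', mul_zero]
    apply mul_left_cancel₀ (pow_ne_zero 2 hp')
    linear_combination hxy

variable {p : ℕ} [hp : Fact p.Prime]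

lemma dvd_and_dvd_of_not_isSquare {D : ℤ} (hD : ¬ IsSquare (-(D : ZMod p))) {x y : ℤ}
    (h : (p : ℤ) ∣ x ^ 2 + D * y ^ 2) : (p : ℤ) ∣ x ∧ (p : ℤ) ∣ y := by
  have h1 : (x : ZMod p) ^ 2 + D * (y : ZMod p) ^ 2 = 0 := by
    have := (ZMod.intCast_zmod_eq_zero_iff_dvd _ p).2 h
    exact_mod_cast this
  rw [← ZMod.intCast_zmod_eq_zero_iff_dvd, ← ZMod.intCast_zmod_eq_zero_iff_dvd]
  have hy : (y : ZMod p) = 0 := by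
    by_contra hy
    refine hD ⟨x / y, ?_⟩
    field_simp
    linear_combination -h1
  rw [hy] at h1
  exact ⟨by simpa using h1, hy⟩

lemma not_isSquare_neg_mul_sq {D a : ZMod p} (ha : a ≠ 0) (hD : ¬ IsSquare (-D)) :
    ¬ IsSquare (-(D * a ^ 2)) := by
  rintro ⟨z, hz⟩
  refine hD ⟨z / a, ?_⟩
  field_simp
  linear_combination hz

/-- A square root of `-3` yields a primitive cube root of unity, but `p - 1` is prime to `3`. -/
lemma not_isSquare_neg_three (hp2 : p ≠ 2) (hp3 : p % 3 = 2) : ¬ IsSquare (-3 : ZMod p) := by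
  rintro ⟨z, hz⟩
  have h2 : (2 : ZMod p) ≠ 0 := by
    intro h
    have := (ZMod.natCast_eq_zero_iff 2 p).1 (by exact_mod_cast h)
    exact hp2 ((Nat.prime_dvd_prime_iff_eq hp.out Nat.prime_two).1 this)
  have h3 : (3 : ZMod p) ≠ 0 := by
    intro h
    have := (ZMod.natCast_eq_zero_iff 3 p).1 (by exact_mod_cast h)
    have := (Nat.prime_dvd_prime_iff_eq hp.out Nat.prime_three).1 this
    omega
  obtain ⟨w, hw⟩ : ∃ w, 2 * w = z - 1 := ⟨(z - 1) / 2, by field_simp⟩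
  have hq : w ^ 2 + w + 1 = 0 := by
    apply mul_left_cancel₀ (mul_ne_zero h2 h2)
    linear_combination (2 * w + z + 1) * hw - hz
  have hw3 : w ^ 3 = 1 := by linear_combination (w - 1) * hq
  have hw0 : w ≠ 0 := by rintro rfl; simp at hw3
  have hw1 : w = 1 := by
    have := ZMod.pow_card_sub_one_eq_one hw0
    rwa [show p - 1 = 3 * (p / 3) + 1 by omega, pow_succ, pow_mul, hw3, one_pow, one_mul] at this
  rw [hw1] at hq
  exact h3 (by linear_combination hq)

/-- The descent step of the cubic form at `p = 2`: for odd `x` and `y` the form is `4` modulo `8`.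
-/
lemma even_and_even_of_sixteen_dvd {x y : ℤ} (h : 16 ∣ x ^ 2 + 27 * y ^ 2) : 2 ∣ x ∧ 2 ∣ y := by
  obtain ⟨k, hk⟩ := h
  rcases Int.even_or_odd' x with ⟨a, rfl | rfl⟩ <;> rcases Int.even_or_odd' y with ⟨b, rfl | rfl⟩
  · exact ⟨⟨a, rfl⟩, ⟨b, rfl⟩⟩
  · ring_nf at hk; omega
  · ring_nf at hk; omega
  · obtain ⟨s, hs⟩ := Int.even_mul_succ_self a
    obtain ⟨t, ht⟩ := Int.even_mul_succ_self b
    ring_nf at hk hs ht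
    omega

variable {j : ℕ}

lemma quartic_rep_eq_zero (hp4 : p % 4 = 3) {x y : ℤ}
    (h : (p : ℤ) ^ (2 * j) = x ^ 2 + 4 * y ^ 2) : y = 0 := by
  refine eq_zero_of_descent hp.out.ne_zero (n := 1) (D := 4) (by norm_num) (by norm_num)
    (fun x y hxy => ?_) j x y (by rw [one_mul, h])
  refine dvd_and_dvd_of_not_isSquare ?_ ((Dvd.intro _ (by ring : (p : ℤ) * p = _)).trans hxy)
  have h2 : (2 : ZMod p) ≠ 0 := by
    intro h
    have := (ZMod.natCast_eq_zero_iff 2 p).1 (by exact_mod_cast h)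
    have := (Nat.prime_dvd_prime_iff_eq hp.out Nat.prime_two).1 this
    omega
  have := not_isSquare_neg_mul_sq (D := 1) h2
    (fun h => (ZMod.exists_sq_eq_neg_one_iff.1 h) hp4)
  push_cast
  convert this using 2
  norm_num

lemma sextic_rep_eq_zero (hp2 : p ≠ 2) (hp3 : p % 3 = 2) {x y : ℤ}
    (h : (p : ℤ) ^ (2 * j) = x ^ 2 + 3 * y ^ 2) : y = 0 := by
  refine eq_zero_of_descent hp.out.ne_zero (n := 1) (D := 3) (by norm_num) (by norm_num)
    (fun x y hxy => ?_) j x y (by rw [one_mul, h])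
  refine dvd_and_dvd_of_not_isSquare ?_ ((Dvd.intro _ (by ring : (p : ℤ) * p = _)).trans hxy)
  exact_mod_cast not_isSquare_neg_three hp2 hp3

lemma octic_rep_eq_zero (hp8 : p % 8 = 7) {x y : ℤ}
    (h : (p : ℤ) ^ (2 * j) = x ^ 2 + 2 * y ^ 2) : y = 0 := by
  refine eq_zero_of_descent hp.out.ne_zero (n := 1) (D := 2) (by norm_num) (by norm_num)
    (fun x y hxy => ?_) j x y (by rw [one_mul, h])
  refine dvd_and_dvd_of_not_isSquare ?_ ((Dvd.intro _ (by ring : (p : ℤ) * p = _)).trans hxy)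
  intro hs
  have := (ZMod.exists_sq_eq_neg_two_iff (p := p) (by omega)).1 (by exact_mod_cast hs)
  omega

lemma cubic_rep_eq_zero (hp3 : p % 3 = 2) {x y : ℤ}
    (h : 4 * (p : ℤ) ^ (2 * j) = x ^ 2 + 27 * y ^ 2) : y = 0 := by
  refine eq_zero_of_descent hp.out.ne_zero (n := 4) (D := 27) (by norm_num) (by norm_num)
    (fun x y hxy => ?_) j x y h
  by_cases hp2 : p = 2
  · subst hp2
    exact even_and_even_of_sixteen_dvd (by simpa using hxy)
  refine dvd_and_dvd_of_not_isSquare ?_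
    ((Dvd.intro _ (by ring : (p : ℤ) * (4 * p) = _)).trans hxy)
  have h3 : (3 : ZMod p) ≠ 0 := by
    intro h
    have := (ZMod.natCast_eq_zero_iff 3 p).1 (by exact_mod_cast h)
    have := (Nat.prime_dvd_prime_iff_eq hp.out Nat.prime_three).1 this
    omega
  have := not_isSquare_neg_mul_sq h3 (not_isSquare_neg_three hp2 hp3)
  push_cast
  convert this using 2
  norm_num

end Representations

/-! ### The general classification criterion. -/

section Classification

lemma even_of_pow_mod_eq_one {p e m : ℕ} (he : 1 < e) (h2 : p ^ 2 % e = 1) (h1 : p % e ≠ 1)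
    (hm : p ^ m % e = 1) : Even m := by
  by_contra hodd
  obtain ⟨k, rfl⟩ := Nat.not_even_iff_odd.1 hodd
  rw [pow_succ, pow_mul, Nat.mul_mod, Nat.pow_mod, h2, one_pow, Nat.mod_eq_of_lt he, one_mul,
    Nat.mod_mod] at hm
  exact h1 hm

lemma even_of_mod_eq_sub_one {p e m : ℕ} (he : 2 < e) (hp : p % e = e - 1)
    (hm : p ^ m % e = 1) : Even m := by
  refine even_of_pow_mod_eq_one (by omega) ?_ (by omega) hm
  have h1 : p + 1 = e * (p / e + 1) := by
    have := Nat.div_add_mod p e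
    rw [mul_add]; omega
  have h2 : p - 1 + 1 = p := Nat.sub_add_cancel (by
    rcases Nat.eq_zero_or_pos p with rfl | h
    · simp at hp; omega
    · exact h)
  have h3 : p ^ 2 = e * ((p / e + 1) * (p - 1)) + 1 := by
    rw [← mul_assoc, ← h1]
    nlinarith
  rw [h3, Nat.mul_add_mod, Nat.mod_eq_of_lt (by omega)]

lemma exists_neg_pow_eq_one_add_mul {p e c : ℕ} (hc : p + 1 = e * c) (j : ℕ) :
    ∃ t : ℤ, (-(p : ℤ)) ^ j = 1 + e * t := by
  obtain ⟨t, ht⟩ := exists_neg_pow_eq p j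
  exact ⟨c * t, by rw [ht, hc]; push_cast; ring⟩

variable {F : Type*} [Field F] [Fintype F] {p m e f : ℕ}

lemma not_dvd_of_card_eq (hq : Fintype.card F = e * f + 1) (hm : Fintype.card F = p ^ m)
    {r : ℕ} (hr : r ∣ e) (hr1 : r ≠ 1) : ¬ r ∣ p := by
  intro h
  have h1 : r ∣ e * f + 1 := by
    rw [← hq, hm]
    refine dvd_pow h ?_
    rintro rfl
    have := Fintype.one_lt_card (α := F)
    simp [hm] at this
  exact hr1 (Nat.dvd_one.1 ((Nat.dvd_add_right (hr.mul_right f)).1 h1))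

variable [DecidableEq F] [hp : Fact p.Prime] [CharP F p]

/-- If cyclotomic partial difference sets containing `-1` occur only in the semiprimitive case,
then the proper ones are exactly the semiprimitive ones. -/
lemma exists_isProperPDS_iff (hq : Fintype.card F = e * f + 1) (hm : Fintype.card F = p ^ m)
    (he : 2 < e)
    (hno : p % e ≠ e - 1 → (-1 : F) ^ f = 1 →
      ∀ n k lam mu, ¬ IsPDS (unityRoots F f) n k lam mu)
    (hprop : ∀ t : ℤ, 2 * t ≠ 1 + e * t) :
    (∃ n k lam mu, IsProperPDS (unityRoots F f) n k lam mu) ↔ p % e = e - 1 ∧ Even m := by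
  constructor
  · rintro ⟨n, k, lam, mu, h⟩
    have hpe : p % e = e - 1 := by
      by_contra hpe
      exact hno hpe (h.neg_one_pow_eq_one hq) _ _ _ _ h.1
    refine ⟨hpe, even_of_mod_eq_sub_one he hpe ?_⟩
    rw [← hm, hq, Nat.mul_add_mod, Nat.mod_eq_of_lt (by omega)]
  · rintro ⟨hpe, j, hj⟩
    have hc : p + 1 = e * (p / e + 1) := by
      have := Nat.div_add_mod p e
      rw [mul_add]; omega
    rw [hj, ← two_mul] at hm
    obtain ⟨n, k, lam, mu, h⟩ := exists_isPDS_of_semiprimitive hq (by omega) hc hm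
    refine ⟨n, k, lam, mu, h, ?_⟩
    rintro rfl
    obtain ⟨-, -, h1, h2⟩ := h.semiprimitive_parameters hq (by omega) hc hm
    obtain ⟨t, ht⟩ := exists_neg_pow_eq_one_add_mul hc j
    rw [h1, ht] at h2
    have he2 : (e : ℤ) ^ 2 ≠ 0 := pow_ne_zero _ (by exact_mod_cast (by omega : e ≠ 0))
    -- With `σ = 1 + e * t`, equality of `lam` and `mu` amounts to `2 * t = 1 + e * t`.
    refine hprop t (mul_left_cancel₀ he2 ?_)
    linear_combination -h2

end Classification

/-! ### The four cases `e = 3, 4, 6, 8`. -/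

theorem mainTheorem5 {F : Type*} [Field F] [Fintype F] [DecidableEq F]
    (p m q : ℕ) (hp : p.Prime) (hq : q = p ^ m) (hF : Fintype.card F = q)
    (α : Fˣ) (hα : ∀ u : Fˣ, u ∈ Subgroup.zpowers α) :
    -- e = 3
    ((∃ f, q = 3 * f + 1) →
      ((∃ n k lam mu, IsPDS (cyclotomicClass α 3 0) n k lam mu) ↔ p % 3 = 2 ∧ Even m) ∧
      ∀ c d : ℤ, IsProperRepCubic p q c d →
        ((∃ n k lam mu, IsPDS (cyclotomicClass α 3 0) n k lam mu) ↔ d = 0) ∧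
        ∀ n k lam mu, IsPDS (cyclotomicClass α 3 0) n k lam mu →
          n = q ∧ (k : ℚ) = ((q : ℚ) - 1) / 3 ∧
          (lam : ℚ) = ((q : ℚ) - 8 + c) / 9 ∧ (mu : ℚ) = (2 * (q : ℚ) - 4 - c) / 18 ∧
          (lam ≠ mu ↔ q ≠ 4)) ∧
    -- e = 4
    ((∃ f, q = 4 * f + 1) →
      ((∃ n k lam mu, IsProperPDS (cyclotomicClass α 4 0) n k lam mu) ↔ p % 4 = 3 ∧ Even m) ∧
      ∀ s t : ℤ, IsProperRepQuartic p q s t →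
        ((∃ n k lam mu, IsProperPDS (cyclotomicClass α 4 0) n k lam mu) ↔ t = 0) ∧
        ∀ n k lam mu, IsProperPDS (cyclotomicClass α 4 0) n k lam mu →
          n = q ∧ (k : ℚ) = ((q : ℚ) - 1) / 4 ∧
          (lam : ℚ) = ((q : ℚ) - 11 - 6 * s) / 16 ∧ (mu : ℚ) = ((q : ℚ) - 3 + 2 * s) / 16) ∧
    -- e = 6
    ((∃ f, q = 6 * f + 1) →
      ((∃ n k lam mu, IsProperPDS (cyclotomicClass α 6 0) n k lam mu) ↔ p % 6 = 5 ∧ Even m) ∧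
      ∀ s t : ℤ, IsProperRepSextic p q s t →
        ((∃ n k lam mu, IsProperPDS (cyclotomicClass α 6 0) n k lam mu) ↔ t = 0) ∧
        ∀ n k lam mu, IsProperPDS (cyclotomicClass α 6 0) n k lam mu →
          n = q ∧ (k : ℚ) = ((q : ℚ) - 1) / 6 ∧
          (lam : ℚ) = ((q : ℚ) - 17 - 20 * s) / 36 ∧ (mu : ℚ) = ((q : ℚ) - 5 + 4 * s) / 36) ∧
    -- e = 8
    ((∃ f, q = 8 * f + 1) →
      ((∃ n k lam mu, IsProperPDS (cyclotomicClass α 8 0) n k lam mu) ↔ p % 8 = 7 ∧ Even m) ∧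
      ∀ x y a b : ℤ, IsProperRepQuartic p q x y → IsProperRepOctic p q a b →
        ((∃ n k lam mu, IsProperPDS (cyclotomicClass α 8 0) n k lam mu) ↔
          x = a ∧ y = 0 ∧ b = 0) ∧
        ∀ n k lam mu, IsProperPDS (cyclotomicClass α 8 0) n k lam mu →
          n = q ∧ (k : ℚ) = ((q : ℚ) - 1) / 8 ∧
          (lam : ℚ) = ((q : ℚ) - 23 - 42 * x) / 64 ∧ (mu : ℚ) = ((q : ℚ) - 7 + 6 * x) / 64) := by
  have : Fact p.Prime := ⟨hp⟩
  have hm : Fintype.card F = p ^ m := hF.trans hq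
  have : CharP F p := charP_of_card_eq_prime_pow (f := m) (by rw [hm])
  have hm0 : m ≠ 0 := by
    rintro rfl
    have := Fintype.one_lt_card (α := F)
    simp [hm] at this
  have hpq : (p : ℤ) ∣ (q : ℤ) := by
    rw [hq]; exact_mod_cast dvd_pow_self p hm0
  have hpZ : Prime (p : ℤ) := Nat.prime_iff_prime_int.1 hp
  have hqσ {j : ℕ} (hj : m = j + j) : Fintype.card F = p ^ (2 * j) := by rw [hm, hj, two_mul]
  have hqσ' {j : ℕ} (hj : m = j + j) : (q : ℤ) = (p : ℤ) ^ (2 * j) := by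
    rw [hq, hj, two_mul]; push_cast; rfl
  refine ⟨?_, ?_, ?_, ?_⟩
  · rintro ⟨f, hf⟩
    have hef : Fintype.card F = 3 * f + 1 := hF.trans hf
    rw [cyclotomicClass_zero_eq hef α hα]
    -- `-1` is a cube, so properness is not needed to place it in the class.
    have hneg : (-1 : F) ^ f = 1 := by
      have h := pow_eq_one_of_card_eq hef (neg_ne_zero.2 (one_ne_zero (α := F)))
      rwa [pow_mul, show (-1 : F) ^ 3 = -1 by norm_num] at h
    have hcop : ¬ 3 ∣ p := not_dvd_of_card_eq hef hm dvd_rfl (by norm_num)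
    have hq1 : p ^ m % 3 = 1 := by omega
    have hiff : (∃ n k lam mu, IsPDS (unityRoots F f) n k lam mu) ↔ p % 3 = 2 ∧ Even m := by
      constructor
      · rintro ⟨n, k, lam, mu, h⟩
        have hp3 : p % 3 = 2 := by
          by_contra hp3
          exact not_isPDS_of_one_mod hm hef (by norm_num) (by omega) hneg h
        exact ⟨hp3, even_of_mod_eq_sub_one (by norm_num) hp3 hq1⟩
      · rintro ⟨hp3, j, hj⟩
        exact exists_isPDS_of_semiprimitive hef (by norm_num) (c := p / 3 + 1) (by omega) (hqσ hj)
    refine ⟨hiff, ?_⟩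
    rintro c d ⟨hrep, hc3, hpc⟩
    refine ⟨hiff.trans ⟨?_, ?_⟩, ?_⟩
    · rintro ⟨hp3, j, hj⟩
      exact cubic_rep_eq_zero (j := j) hp3 (by rw [← hqσ' hj, hrep])
    · rintro rfl
      have hp3 : p % 3 = 2 := by
        by_contra hp3
        refine hpc (by omega) (hpZ.dvd_of_dvd_pow (n := 2) ?_)
        rw [show c ^ 2 = 4 * q by rw [hrep]; ring]
        exact hpq.mul_left 4
      exact ⟨hp3, even_of_mod_eq_sub_one (by norm_num) hp3 hq1⟩
    · intro n k lam mu h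
      obtain ⟨hp3, j, hj⟩ := hiff.1 ⟨n, k, lam, mu, h⟩
      have hc : p + 1 = 3 * (p / 3 + 1) := by omega
      have hd : d = 0 := cubic_rep_eq_zero (j := j) hp3 (by rw [← hqσ' hj, hrep])
      obtain ⟨hn, hk, hmu, hlam⟩ := h.semiprimitive_parameters hef (by norm_num) hc (hqσ hj)
      obtain ⟨t, ht⟩ := exists_neg_pow_eq_one_add_mul hc j
      have hsq : (q : ℤ) = ((-(p : ℤ)) ^ j) ^ 2 := by rw [← hF]; exact card_eq_sq (hqσ hj)
      generalize (-(p : ℤ)) ^ j = σ at *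
      -- Here `c = ±2σ`, and `σ ≡ 1` mod `3` leaves only the negative sign.
      have hcσ : c = -2 * σ := by
        have : c ^ 2 = (2 * σ) ^ 2 := by rw [hd] at hrep; linear_combination 4 * hsq - hrep
        rcases sq_eq_sq_iff_eq_or_eq_neg.1 this with h | h
        · rw [Int.ModEq] at hc3; push_cast at ht; omega
        · rw [h]; ring
      have hsqQ : (q : ℚ) = (σ : ℚ) ^ 2 := by exact_mod_cast hsq
      have hkQ : (q : ℚ) = 3 * f + 1 := by exact_mod_cast hf
      have hmuQ : (3 : ℚ) ^ 2 * mu = (σ - 1) * (σ - 1 + 3) := by exact_mod_cast hmu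
      have hlamQ : (3 : ℚ) ^ 2 * lam = (σ - 1) * (σ - 1 + 3) +
        (2 * 3 * (σ - 1) - 3 ^ 2 * σ) := by exact_mod_cast hlam
      refine ⟨hn.trans hF, by rw [hk, hkQ]; ring, ?_, ?_, ?_⟩
      · rw [hcσ, hsqQ]; push_cast; linear_combination hlamQ / 9
      · rw [hcσ, hsqQ]; push_cast; linear_combination hmuQ / 9
      -- Equal frequencies mean `σ = -2`; conversely `q = 4` gives `σ = ±2`, and `σ ≡ 1` mod `3`
      -- excludes `2`.
      · rw [not_iff_not]
        push_cast at hmu hlam ht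
        constructor
        · rintro rfl
          have : σ = -2 := by linarith
          zify
          rw [hsq, this]
          norm_num
        · rintro rfl
          have : σ ^ 2 = 2 ^ 2 := by rw [← hsq]; norm_num
          rcases sq_eq_sq_iff_eq_or_eq_neg.1 this with h | h
          · omega
          · rw [h] at hmu hlam; omega
  · rintro ⟨f, hf⟩
    have hef : Fintype.card F = 4 * f + 1 := hF.trans hf
    rw [cyclotomicClass_zero_eq hef α hα]
    have hcop : ¬ 2 ∣ p := not_dvd_of_card_eq hef hm (by norm_num) (by norm_num)
    have hq1 : p ^ m % 4 = 1 := by omega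
    have hiff := exists_isProperPDS_iff hef hm (by norm_num)
      (fun hpe hneg _ _ _ _ => not_isPDS_of_one_mod hm hef (by norm_num) (by omega) hneg)
      (fun t => by push_cast; omega)
    simp only [Nat.reduceSub] at hiff
    refine ⟨hiff, ?_⟩
    rintro s t ⟨hrep, hs4, hps⟩
    refine ⟨hiff.trans ⟨?_, ?_⟩, ?_⟩
    · rintro ⟨hp4, j, hj⟩
      exact quartic_rep_eq_zero (j := j) hp4 (by rw [← hqσ' hj, hrep])
    · rintro rfl
      have hp4 : p % 4 = 3 := by
        by_contra hp4
        refine hps (by omega) (hpZ.dvd_of_dvd_pow (n := 2) ?_)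
        rwa [show s ^ 2 = q by rw [hrep]; ring]
      exact ⟨hp4, even_of_mod_eq_sub_one (by norm_num) hp4 hq1⟩
    · intro n k lam mu h
      obtain ⟨hp4, j, hj⟩ := hiff.1 ⟨n, k, lam, mu, h⟩
      have hc : p + 1 = 4 * (p / 4 + 1) := by omega
      have ht0 : t = 0 := quartic_rep_eq_zero (j := j) hp4 (by rw [← hqσ' hj, hrep])
      obtain ⟨hn, hk, hmu, hlam⟩ := h.1.semiprimitive_parameters hef (by norm_num) hc (hqσ hj)
      obtain ⟨r, hr⟩ := exists_neg_pow_eq_one_add_mul hc j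
      have hsq : (q : ℤ) = ((-(p : ℤ)) ^ j) ^ 2 := by rw [← hF]; exact card_eq_sq (hqσ hj)
      generalize (-(p : ℤ)) ^ j = σ at *
      have hsσ : s = σ := by
        have : s ^ 2 = σ ^ 2 := by rw [ht0] at hrep; linear_combination hsq - hrep
        rcases sq_eq_sq_iff_eq_or_eq_neg.1 this with h | h
        · exact h
        · rw [Int.ModEq] at hs4; push_cast at hr; omega
      have hsqQ : (q : ℚ) = (σ : ℚ) ^ 2 := by exact_mod_cast hsq
      have hkQ : (q : ℚ) = 4 * f + 1 := by exact_mod_cast hf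
      have hmuQ : (4 : ℚ) ^ 2 * mu = (σ - 1) * (σ - 1 + 4) := by exact_mod_cast hmu
      have hlamQ : (4 : ℚ) ^ 2 * lam = (σ - 1) * (σ - 1 + 4) +
        (2 * 4 * (σ - 1) - 4 ^ 2 * σ) := by exact_mod_cast hlam
      refine ⟨hn.trans hF, by rw [hk, hkQ]; ring, ?_, ?_⟩
      · rw [hsσ, hsqQ]; linear_combination hlamQ / 16
      · rw [hsσ, hsqQ]; linear_combination hmuQ / 16
  · rintro ⟨f, hf⟩
    have hef : Fintype.card F = 6 * f + 1 := hF.trans hf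
    rw [cyclotomicClass_zero_eq hef α hα]
    have hcop2 : ¬ 2 ∣ p := not_dvd_of_card_eq hef hm (by norm_num) (by norm_num)
    have hcop3 : ¬ 3 ∣ p := not_dvd_of_card_eq hef hm (by norm_num) (by norm_num)
    have hq1 : p ^ m % 6 = 1 := by omega
    have hiff := exists_isProperPDS_iff hef hm (by norm_num)
      (fun hpe hneg _ _ _ _ => not_isPDS_of_one_mod hm hef (by norm_num) (by omega) hneg)
      (fun t => by push_cast; omega)
    simp only [Nat.reduceSub] at hiff
    refine ⟨hiff, ?_⟩
    rintro s t ⟨hrep, hs3, hps⟩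
    refine ⟨hiff.trans ⟨?_, ?_⟩, ?_⟩
    · rintro ⟨hp6, j, hj⟩
      exact sextic_rep_eq_zero (p := p) (j := j) (by omega) (by omega) (by rw [← hqσ' hj, hrep])
    · rintro rfl
      have hp6 : p % 6 = 5 := by
        by_contra hp6
        refine hps (by omega) (hpZ.dvd_of_dvd_pow (n := 2) ?_)
        rwa [show s ^ 2 = q by rw [hrep]; ring]
      exact ⟨hp6, even_of_mod_eq_sub_one (by norm_num) hp6 hq1⟩
    · intro n k lam mu h
      obtain ⟨hp6, j, hj⟩ := hiff.1 ⟨n, k, lam, mu, h⟩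
      have hc : p + 1 = 6 * (p / 6 + 1) := by omega
      have ht0 : t = 0 :=
        sextic_rep_eq_zero (p := p) (j := j) (by omega) (by omega) (by rw [← hqσ' hj, hrep])
      obtain ⟨hn, hk, hmu, hlam⟩ := h.1.semiprimitive_parameters hef (by norm_num) hc (hqσ hj)
      obtain ⟨r, hr⟩ := exists_neg_pow_eq_one_add_mul hc j
      have hsq : (q : ℤ) = ((-(p : ℤ)) ^ j) ^ 2 := by rw [← hF]; exact card_eq_sq (hqσ hj)
      generalize (-(p : ℤ)) ^ j = σ at *
      have hsσ : s = σ := by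
        have : s ^ 2 = σ ^ 2 := by rw [ht0] at hrep; linear_combination hsq - hrep
        rcases sq_eq_sq_iff_eq_or_eq_neg.1 this with h | h
        · exact h
        · rw [Int.ModEq] at hs3; push_cast at hr; omega
      have hsqQ : (q : ℚ) = (σ : ℚ) ^ 2 := by exact_mod_cast hsq
      have hkQ : (q : ℚ) = 6 * f + 1 := by exact_mod_cast hf
      have hmuQ : (6 : ℚ) ^ 2 * mu = (σ - 1) * (σ - 1 + 6) := by exact_mod_cast hmu
      have hlamQ : (6 : ℚ) ^ 2 * lam = (σ - 1) * (σ - 1 + 6) +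
        (2 * 6 * (σ - 1) - 6 ^ 2 * σ) := by exact_mod_cast hlam
      refine ⟨hn.trans hF, by rw [hk, hkQ]; ring, ?_, ?_⟩
      · rw [hsσ, hsqQ]; linear_combination hlamQ / 36
      · rw [hsσ, hsqQ]; linear_combination hmuQ / 36
  · rintro ⟨f, hf⟩
    have hef : Fintype.card F = 8 * f + 1 := hF.trans hf
    rw [cyclotomicClass_zero_eq hef α hα]
    have hcop : ¬ 2 ∣ p := not_dvd_of_card_eq hef hm (by norm_num) (by norm_num)
    have hq1 : p ^ m % 8 = 1 := by omega
    have hiff := exists_isProperPDS_iff hef hm (by norm_num) (fun hpe hneg n k lam mu => by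
        have hcases : p % 8 = 1 ∨ p % 8 = 3 ∨ p % 8 = 5 := by omega
        -- Here `p` has order `2` modulo `8`, so `q ≡ 1` mod `8` makes `m` even and the two-digit
        -- blocks of `f` apply.
        have heven (h : p % 8 = 3 ∨ p % 8 = 5) : ∃ j, Fintype.card F = p ^ (2 * j) := by
          obtain ⟨j, hj⟩ := even_of_pow_mod_eq_one (by norm_num)
            (by rcases h with h | h <;> rw [Nat.pow_mod, h]) (by omega) hq1
          exact ⟨j, hqσ hj⟩
        rcases hcases with h | h | h
        · exact not_isPDS_of_one_mod hm hef (by norm_num) h hneg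
        · obtain ⟨j, hj⟩ := heven (Or.inl h)
          exact not_isPDS_eight_of_three_mod hj hef h hneg
        · obtain ⟨j, hj⟩ := heven (Or.inr h)
          exact not_isPDS_eight_of_five_mod hj hef h hneg)
      (fun t => by push_cast; omega)
    simp only [Nat.reduceSub] at hiff
    refine ⟨hiff, ?_⟩
    rintro x y a b ⟨hrep, hx4, hpx⟩ ⟨hrep', ha4, hpa⟩
    have key (j : ℕ) (hp8 : p % 8 = 7) (hj : m = j + j) :
        y = 0 ∧ b = 0 ∧ x = (-(p : ℤ)) ^ j ∧ a = (-(p : ℤ)) ^ j := by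
      have hc : p + 1 = 8 * (p / 8 + 1) := by omega
      have hy : y = 0 := quartic_rep_eq_zero (p := p) (j := j) (by omega) (by rw [← hqσ' hj, hrep])
      have hb : b = 0 := octic_rep_eq_zero (j := j) hp8 (by rw [← hqσ' hj, hrep'])
      obtain ⟨r, hr⟩ := exists_neg_pow_eq_one_add_mul hc j
      have hsq : (q : ℤ) = ((-(p : ℤ)) ^ j) ^ 2 := by rw [← hF]; exact card_eq_sq (hqσ hj)
      generalize (-(p : ℤ)) ^ j = σ at *
      have huniq (z : ℤ) (hz : z ^ 2 = σ ^ 2) (hz4 : z ≡ 1 [ZMOD 4]) : z = σ := by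
        rcases sq_eq_sq_iff_eq_or_eq_neg.1 hz with h | h
        · exact h
        · rw [Int.ModEq] at hz4; push_cast at hr; omega
      exact ⟨hy, hb, huniq x (by rw [hy] at hrep; linear_combination hsq - hrep) hx4,
        huniq a (by rw [hb] at hrep'; linear_combination hsq - hrep') ha4⟩
    refine ⟨hiff.trans ⟨?_, ?_⟩, ?_⟩
    · rintro ⟨hp8, j, hj⟩
      obtain ⟨hy, hb, hx, ha⟩ := key j hp8 hj
      exact ⟨hx.trans ha.symm, hy, hb⟩
    · rintro ⟨rfl, rfl, rfl⟩
      have hdvd : (p : ℤ) ∣ x := by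
        refine hpZ.dvd_of_dvd_pow (n := 2) ?_
        rwa [show x ^ 2 = q by rw [hrep]; ring]
      -- With `y = b = 0`, `p` divides `x = a`. The quartic normalization excludes `1, 5` mod `8`,
      -- and the octic one excludes `1, 3`.
      have hp8 : p % 8 = 7 := by
        by_contra hp8
        have h1 : ¬ p % 4 = 1 := fun h => hpx h hdvd
        have h2 : ¬ (p % 8 = 1 ∨ p % 8 = 3) := fun h => hpa h hdvd
        omega
      exact ⟨hp8, even_of_mod_eq_sub_one (by norm_num) hp8 hq1⟩
    · intro n k lam mu h
      obtain ⟨hp8, j, hj⟩ := hiff.1 ⟨n, k, lam, mu, h⟩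
      obtain ⟨-, -, hxσ, -⟩ := key j hp8 hj
      have hc : p + 1 = 8 * (p / 8 + 1) := by omega
      obtain ⟨hn, hk, hmu, hlam⟩ := h.1.semiprimitive_parameters hef (by norm_num) hc (hqσ hj)
      have hsq : (q : ℤ) = ((-(p : ℤ)) ^ j) ^ 2 := by rw [← hF]; exact card_eq_sq (hqσ hj)
      rw [← hxσ] at hmu hlam hsq
      have hsqQ : (q : ℚ) = (x : ℚ) ^ 2 := by exact_mod_cast hsq
      have hkQ : (q : ℚ) = 8 * f + 1 := by exact_mod_cast hf
      have hmuQ : (8 : ℚ) ^ 2 * mu = (x - 1) * (x - 1 + 8) := by exact_mod_cast hmu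
      have hlamQ : (8 : ℚ) ^ 2 * lam = (x - 1) * (x - 1 + 8) +
        (2 * 8 * (x - 1) - 8 ^ 2 * x) := by exact_mod_cast hlam
      refine ⟨hn.trans hF, by rw [hk, hkQ]; ring, ?_, ?_⟩
      · rw [hsqQ]; linear_combination hlamQ / 64
      · rw [hsqQ]; linear_combination hmuQ / 64
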